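/- Let $\alpha$ be an indeterminate. A shifted symmetric function is a family $f=(f_N)_{N\ge 0}$, where $f_N$ is a polynomial in $x_1,\dots,x_N$ over $\mathbf{Q}(\alpha)$ that is symmetric in the shifted variables $x_i-i/\alpha$, such that $f_{N+1}(x_1,\dots,x_N,0)=f_N(x_1,\dots,x_N)$ for all $N$ and the degrees of the $f_N$ are bounded. These families form the shifted symmetric algebra $\mathcal{S}^{*}$ over $\mathbf{Q}(\alpha)$. For a partition $\lambda$ put $f(\lambda)=f_N(\lambda_1,\dots,\lambda_N)$ for any $N\ge l(\lambda)$; the element $f$ is determined by the function $\lambda\mapsto f(\lambda)$, and $\mathcal{S}^{*}$ is regarded in this way as an algebra of functions on partitions. For a partition $\lambda$, consider its Young diagram as the union of the unit boxes $[j-1,j]\times[i-1,i]$ with $1\le i\le l(\lambda)$, $1\le j\le\lambda_i$, in $\mathbf{R}^2$. An inside corner is the south-west vertex of a box of the complement (in the quadrant) that may be added to the diagram so as to give again the diagram of a partition; an outside corner is the north-east vertex of a box that may be removed from it in the same sense. Give the point $(u,v)$ the $\alpha$-content $u-v/\alpha$; let $x_1,\dots,x_d$ and $y_1,\dots,y_{d-1}$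 be the $\alpha$-contents of the inside and of the outside corners. The anisotropic transition measure is $$\omega_\lambda=\sum_{k=1}^d\sigma_k\,\delta_{x_k},\qquad \sigma_k=\frac{\prod_{i=1}^{d-1}(x_k-y_i)}{\prod_{i\ne k}(x_k-x_i)},$$ and its moments $M_k(\lambda)=\sum_{i=1}^d\sigma_i x_i^k\in\mathbf{Q}(\alpha)$ satisfy $$\mathcal{M}_\lambda(z)=z^{-1}+\sum_{k\ge1}M_k(\lambda)z^{-k-1}=\frac{\prod_{i=1}^{d-1}(z-y_i)}{\prod_{i=1}^{d}(z-x_i)}.$$ The Boolean cumulants $B_k(\lambda)$ and the free cumulants $R_k(\lambda)$ are defined by $$\mathcal{M}_\lambda(z)^{-1}=z-\sum_{k\ge1}B_k(\lambda)z^{1-k},\qquad \mathcal{M}_\lambda^{(-1)}(u)=u^{-1}+\sum_{k\ge1}R_k(\lambda)u^{k-1},$$ where $\mathcal{M}_\lambda^{(-1)}$ is the compositional inverse of $\mathcal{M}_\lambda$. Theorem. As functions of $\lambda$, the moments $M_k$, the Boolean cumulants $B_k$ and the free cumulants $R_k$, $k\ge2$, belong to $\mathcal{S}^{*}$. Each of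 the three families $\{M_k\}_{k\ge2}$, $\{B_k\}_{k\ge2}$, $\{R_k\}_{k\ge2}$ is an algebraic basis of $\mathcal{S}^{*}$, that is, it is algebraically independent over $\mathbf{Q}(\alpha)$ and generates the $\mathbf{Q}(\alpha)$-algebra $\mathcal{S}^{*}$. Moreover $M_k$, $B_k$, $R_k$ are polynomials in $1/\alpha$: for each such element $f=(f_N)$ of $\mathcal{S}^{*}$, all coefficients of all the polynomials $f_N$ are polynomials in $1/\alpha$ with rational coefficients, of degree bounded independently of $N$. -/

import Mathlib

noncomputable section

namespace AnisotropicYoung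

open Finset

/-! ### Coefficient field and contents -/

/-- The field `ℚ(α)` of rational functions in the indeterminate `α`. -/
abbrev Coef : Type := RatFunc ℚ

/-- The indeterminate `α`. -/
def α : Coef := RatFunc.X

/-- The `α`-content `c(u, v) = u - v / α` of the lattice point with abscissa `u`, ordinate `v`. -/
def content (u v : ℕ) : Coef := (u : Coef) - (v : Coef) / α

/-! ### Shifted symmetric functions -/

/-- A polynomial in `x₁, …, x_N` over `ℚ(α)` is shifted symmetric if it is a symmetric polynomial
in the shifted variables `x_i - i / α`.  (The variable `x_i` is `X ⟨i - 1, _⟩`.) -/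
def IsShiftedSymmetric {N : ℕ} (p : MvPolynomial (Fin N) Coef) : Prop :=
  ∃ q : MvPolynomial (Fin N) Coef, q.IsSymmetric ∧
    p = MvPolynomial.aeval
      (fun i : Fin N => MvPolynomial.X i - MvPolynomial.C (((i : ℕ) + 1 : Coef) / α)) q

/-- The substitution `f(x₁, …, x_N, x_{N+1}) ↦ f(x₁, …, x_N, 0)`. -/
def setLastZero (N : ℕ) : MvPolynomial (Fin (N + 1)) Coef →ₐ[Coef] MvPolynomial (Fin N) Coef :=
  MvPolynomial.aeval (Fin.snoc (α := fun _ => MvPolynomial (Fin N) Coef) MvPolynomial.X 0)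

/-- The algebra `S*` of shifted symmetric functions: the families `(f_N)` of shifted symmetric
polynomials in `N` variables, of bounded degree, with `f_{N+1}(x₁, …, x_N, 0) = f_N(x₁, …, x_N)`. -/
def ShiftedSym : Subalgebra Coef ((N : ℕ) → MvPolynomial (Fin N) Coef) where
  carrier := {f | (∀ N, IsShiftedSymmetric (f N)) ∧ (∀ N, setLastZero N (f (N + 1)) = f N) ∧
    ∃ D : ℕ, ∀ N, (f N).totalDegree ≤ D}
  mul_mem' := by
    rintro f g ⟨hf, hf', D, hD⟩ ⟨hg, hg', E, hE⟩
    refine ⟨fun N => ?_, fun N => ?_, D + E, fun N => ?_⟩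
    · obtain ⟨p, hp, hp'⟩ := hf N
      obtain ⟨q, hq, hq'⟩ := hg N
      exact ⟨p * q, hp.mul hq, by rw [Pi.mul_apply, hp', hq', map_mul]⟩
    · rw [Pi.mul_apply, map_mul, hf', hg', Pi.mul_apply]
    · exact (MvPolynomial.totalDegree_mul _ _).trans (add_le_add (hD N) (hE N))
  add_mem' := by
    rintro f g ⟨hf, hf', D, hD⟩ ⟨hg, hg', E, hE⟩
    refine ⟨fun N => ?_, fun N => ?_, max D E, fun N => ?_⟩
    · obtain ⟨p, hp, hp'⟩ := hf N
      obtain ⟨q, hq, hq'⟩ := hg N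
      exact ⟨p + q, hp.add hq, by rw [Pi.add_apply, hp', hq', map_add]⟩
    · rw [Pi.add_apply, map_add, hf', hg', Pi.add_apply]
    · exact (MvPolynomial.totalDegree_add _ _).trans (max_le_max (hD N) (hE N))
  algebraMap_mem' := by
    intro r
    refine ⟨fun N => ⟨MvPolynomial.C r, MvPolynomial.IsSymmetric.C r, ?_⟩, fun N => ?_, 0,
      fun N => ?_⟩
    · rw [Pi.algebraMap_apply, MvPolynomial.algebraMap_eq, MvPolynomial.aeval_C,
        MvPolynomial.algebraMap_eq]
    · rw [Pi.algebraMap_apply, AlgHom.commutes, Pi.algebraMap_apply]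
    · rw [Pi.algebraMap_apply, MvPolynomial.algebraMap_eq, MvPolynomial.totalDegree_C]

/-- The value `f(λ) = f_N(λ₁, …, λ_N)` of a shifted symmetric function at a partition `λ`, where
`N = l(λ)` is the number of parts of `λ`. -/
def evalAt (f : ShiftedSym) (l : YoungDiagram) : Coef :=
  MvPolynomial.eval (fun i : Fin (l.colLen 0) => (l.rowLen i : Coef)) (f.1 (l.colLen 0))

/-- Any number of variables `N ≥ l(λ)` gives the same value. -/
theorem evalAt_eq (f : ShiftedSym) (l : YoungDiagram) (N : ℕ) (hN : l.colLen 0 ≤ N) :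
    evalAt f l = MvPolynomial.eval (fun i : Fin N => (l.rowLen i : Coef)) (f.1 N) := by
  induction N, hN using Nat.le_induction with
  | base => rfl
  | succ N hN ih =>
    rw [ih, ← f.2.2.1 N, setLastZero, ← MvPolynomial.coe_aeval_eq_eval,
      ← MvPolynomial.coe_aeval_eq_eval, RingHom.coe_coe, RingHom.coe_coe,
      MvPolynomial.aeval_def (Fin.snoc _ _), ← MvPolynomial.aeval_def]
    rw [← AlgHom.comp_apply, MvPolynomial.comp_aeval]
    congr 2
    funext i
    refine Fin.lastCases ?_ (fun j => ?_) i
    · have h0 : l.rowLen N = 0 := by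
        by_contra h
        have : (N, 0) ∈ l := YoungDiagram.mem_iff_lt_rowLen.2 (Nat.pos_of_ne_zero h)
        have := YoungDiagram.mem_iff_lt_colLen.1 this
        omega
      simp [h0]
    · simp

/-- A shifted symmetric function is determined by its values at partitions, so that `S*` may be
regarded as an algebra of functions on the set of partitions. -/
theorem evalAt_injective : Function.Injective evalAt := by
  intro f g hfg
  refine Subtype.ext (funext fun N => ?_)
  -- it is enough to test on the vectors `(t₁ + ⋯ + t_N, …, t_{N-1} + t_N, t_N)`
  let s : (Fin N → Coef) → Fin N → Coef := fun t i => ∑ j : Fin N, if i ≤ j then t j else 0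
  let S : Fin N → MvPolynomial (Fin N) Coef :=
    fun i => ∑ j : Fin N, if i ≤ j then MvPolynomial.X j else 0
  have hS : ∀ (t : Fin N → Coef) (p : MvPolynomial (Fin N) Coef),
      MvPolynomial.eval t (MvPolynomial.aeval S p) = MvPolynomial.eval (s t) p := by
    intro t p
    rw [← MvPolynomial.coe_aeval_eq_eval, ← MvPolynomial.coe_aeval_eq_eval, RingHom.coe_coe,
      RingHom.coe_coe, ← AlgHom.comp_apply, MvPolynomial.comp_aeval]
    congr 2
    funext i
    simp only [S, s, map_sum]
    refine sum_congr rfl fun j _ => ?_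
    split_ifs <;> simp
  have key : MvPolynomial.aeval S (f.1 N) = MvPolynomial.aeval S (g.1 N) := by
    refine MvPolynomial.funext_set (fun _ => Set.range (Nat.cast : ℕ → Coef))
      (fun _ => Set.infinite_range_of_injective Nat.cast_injective) fun x hx => ?_
    choose m hm using fun i => hx i (Set.mem_univ i)
    rw [hS, hS]
    let r : ℕ → ℕ := fun i => ∑ j : Fin N, if i ≤ (j : ℕ) then m j else 0
    have hr : Antitone r := fun a b hab => sum_le_sum fun j _ => by
      split_ifs <;> omega
    have hr0 : r N = 0 := sum_eq_zero fun j _ => if_neg (by omega)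
    let l : YoungDiagram :=
      { cells := (range N ×ˢ range (r 0)).filter fun c => c.2 < r c.1
        isLowerSet := by
          intro c d hdc hc
          simp only [coe_filter, mem_product, mem_range, Set.mem_ofPred_eq] at hc ⊢
          have h1 := hdc.1
          have h2 := hdc.2
          have h3 := hr h1
          have h4 := hr (Nat.zero_le d.1)
          omega }
    have hl : ∀ i j, (i, j) ∈ l ↔ j < r i := by
      intro i j
      rw [← YoungDiagram.mem_cells]
      simp only [l, mem_filter, mem_product, mem_range]
      constructor
      · exact fun h => h.2
      · intro h
        refine ⟨⟨?_, ?_⟩, h⟩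
        · by_contra hi
          have := hr (not_lt.1 hi)
          omega
        · have := hr (Nat.zero_le i)
          omega
    have hrow : ∀ i, l.rowLen i = r i := by
      intro i
      refine le_antisymm (not_lt.1 fun h => ?_) (not_lt.1 fun h => ?_)
      · exact lt_irrefl _ ((hl _ _).1 (YoungDiagram.mem_iff_lt_rowLen.2 h))
      · exact lt_irrefl _ (YoungDiagram.mem_iff_lt_rowLen.1 ((hl _ _).2 h))
    have hcol : l.colLen 0 ≤ N := by
      by_contra h
      have := (hl _ _).1 (YoungDiagram.mem_iff_lt_colLen.2 (not_le.1 h))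
      omega
    have hs : s x = fun i : Fin N => (l.rowLen i : Coef) := by
      funext i
      rw [hrow]
      simp only [s, r, Nat.cast_sum]
      refine sum_congr rfl fun j _ => ?_
      by_cases h : i ≤ j
      · rw [if_pos h, if_pos (Fin.le_def.1 h), hm]
      · rw [if_neg h, if_neg (fun h' => h (Fin.le_def.2 h')), Nat.cast_zero]
    rw [hs, ← evalAt_eq f l N hcol, ← evalAt_eq g l N hcol, hfg]
  refine MvPolynomial.funext fun y => ?_
  let Y : ℕ → Coef := fun i => if h : i < N then y ⟨i, h⟩ else 0
  have hy : s (fun j => Y j - Y (j + 1)) = y := by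
    funext i
    have : s (fun j => Y j - Y (j + 1)) i =
        ∑ j ∈ range N, if (i : ℕ) ≤ j then Y j - Y (j + 1) else 0 := by
      rw [← Fin.sum_univ_eq_sum_range (fun j => if (i : ℕ) ≤ j then Y j - Y (j + 1) else 0)]
      rfl
    rw [this, ← sum_filter]
    have h2 : (range N).filter (fun j => (i : ℕ) ≤ j) = Ico (i : ℕ) N := by
      ext j
      simp only [mem_filter, mem_range, mem_Ico]
      omega
    rw [h2]
    have h3 := Finset.sum_Ico_sub Y i.2.le
    have h4 : Y N = 0 := dif_neg (lt_irrefl N)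
    have h5 : Y i = y i := dif_pos i.2
    rw [← h5]
    calc _ = - ∑ j ∈ Ico (i : ℕ) N, (Y (j + 1) - Y j) := by
          rw [← sum_neg_distrib]; exact sum_congr rfl fun j _ => by ring
      _ = _ := by rw [h3, h4]; ring
  have := congrArg (MvPolynomial.eval fun j : Fin N => Y j - Y (j + 1)) key
  rwa [hS, hS, hy] at this

/-- A family of elements of a commutative algebra is an algebraic basis if it is algebraically
independent and generates the algebra. -/
def IsAlgebraicBasis {ι A : Type*} [CommRing A] [Algebra Coef A] (x : ι → A) : Prop :=
  AlgebraicIndependent Coef x ∧ Algebra.adjoin Coef (Set.range x) = ⊤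

/-- A shifted symmetric function `f` is a polynomial in `1 / α`: the coefficients of all the
polynomials `f_N` are polynomials in `1 / α` with rational coefficients, of degree bounded in terms
of `f` only. -/
def IsPolynomialInInvAlpha (f : ShiftedSym) : Prop :=
  ∃ D : ℕ, ∀ (N : ℕ) (m : Fin N →₀ ℕ), ∃ p : Polynomial ℚ, p.natDegree ≤ D ∧
    (f.1 N).coeff m = Polynomial.aeval (1 / α) p

/-! ### The transition measure of the anisotropic Young diagram -/

/-- The cells of the complement of the diagram of `λ` whose south-west vertex is an inside corner.
A cell is a pair (row, column) of indices starting at `0`. -/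
def insideCells (l : YoungDiagram) : Finset (ℕ × ℕ) :=
  (range (l.colLen 0 + 1) ×ˢ range (l.rowLen 0 + 1)).filter fun c =>
    c ∉ l ∧ (∀ i < c.1, (i, c.2) ∈ l) ∧ (∀ j < c.2, (c.1, j) ∈ l)

/-- The cells of the diagram of `λ` whose north-east vertex is an outside corner. -/
def outsideCells (l : YoungDiagram) : Finset (ℕ × ℕ) :=
  l.cells.filter fun c => (c.1 + 1, c.2) ∉ l ∧ (c.1, c.2 + 1) ∉ l

/-- The `α`-content of the south-west vertex of a cell. -/
def swContent (c : ℕ × ℕ) : Coef := content c.2 c.1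

/-- The `α`-content of the north-east vertex of a cell. -/
def neContent (c : ℕ × ℕ) : Coef := content (c.2 + 1) (c.1 + 1)

/-- The mass `σ = ∏_y (x - y) / ∏_{x' ≠ x} (x - x')` of the transition measure of `λ` at the content
`x` of an inside corner; here `y` runs over the contents of the outside corners and `x'` over those
of the other inside corners. -/
def transitionMass (l : YoungDiagram) (c : ℕ × ℕ) : Coef :=
  (∏ d ∈ outsideCells l, (swContent c - neContent d)) /
    ∏ d ∈ (insideCells l).erase c, (swContent c - swContent d)

/-- The `k`-th moment `M_k(λ)` of the transition measure `∑ σ δ_x`, the sum being over the contents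
`x` of the inside corners. -/
def moment (l : YoungDiagram) (k : ℕ) : Coef :=
  ∑ c ∈ insideCells l, transitionMass l c * swContent c ^ k

/-- The series `∑_k M_k(λ) w^k`, that is `z 𝓜_λ(z)` in the variable `w = 1 / z`. -/
def momentSeries (l : YoungDiagram) : PowerSeries Coef := PowerSeries.mk (moment l)

theorem content_injective {u v u' v' : ℕ} (h : content u v = content u' v') :
    u = u' ∧ v = v' := by
  have hα : α ≠ 0 := RatFunc.X_ne_zero
  have h1 : (u : Coef) * α + (v' : Coef) = (u' : Coef) * α + (v : Coef) := by
    unfold content at h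
    field_simp at h
    linear_combination h
  have h2 : (Polynomial.C (u : ℚ) * Polynomial.X + Polynomial.C (v' : ℚ) : Polynomial ℚ) =
      Polynomial.C (u' : ℚ) * Polynomial.X + Polynomial.C (v : ℚ) := by
    apply RatFunc.algebraMap_injective ℚ
    simpa [α] using h1
  have h3 := congrArg (fun p => Polynomial.coeff p 1) h2
  have h4 := congrArg (fun p => Polynomial.coeff p 0) h2
  simp at h3 h4
  exact ⟨h3, h4.symm⟩

theorem swContent_injective : Function.Injective swContent := by
  intro c d h
  obtain ⟨h1, h2⟩ := content_injective h
  exact Prod.ext h2 h1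

/-- There is one more inside corner than there are outside corners. -/
theorem card_insideCells (l : YoungDiagram) :
    (insideCells l).card = (outsideCells l).card + 1 := by
  have hmem : ∀ c : ℕ × ℕ, c ∈ insideCells l ↔ c.2 = l.rowLen c.1 ∧
      (c.1 = 0 ∨ l.rowLen c.1 < l.rowLen (c.1 - 1)) := by
    rintro ⟨i, j⟩
    simp only [insideCells, mem_filter, mem_product, mem_range]
    constructor
    · rintro ⟨-, h1, h2, h3⟩
      rw [YoungDiagram.mem_iff_lt_rowLen] at h1
      have hj : j = l.rowLen i := by
        refine le_antisymm (not_lt.1 fun h => ?_) (not_lt.1 h1)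
        exact lt_irrefl _ (YoungDiagram.mem_iff_lt_rowLen.1 (h3 _ h))
      refine ⟨hj, ?_⟩
      rcases Nat.eq_zero_or_pos i with h | h
      · exact Or.inl h
      · exact Or.inr (hj ▸ YoungDiagram.mem_iff_lt_rowLen.1 (h2 (i - 1) (by omega)))
    · rintro ⟨h1, h2⟩
      have hj : j ≤ l.rowLen 0 := h1 ▸ l.rowLen_anti 0 i (Nat.zero_le i)
      have hi : i ≤ l.colLen 0 := by
        rcases h2 with h2 | h2
        · omega
        · have : (i - 1, 0) ∈ l := YoungDiagram.mem_iff_lt_rowLen.2 (by omega)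
          have := YoungDiagram.mem_iff_lt_colLen.1 this
          omega
      refine ⟨⟨by omega, by omega⟩, ?_, fun a ha => ?_, fun b hb => ?_⟩
      · rw [YoungDiagram.mem_iff_lt_rowLen]; omega
      · rw [YoungDiagram.mem_iff_lt_rowLen]
        have := l.rowLen_anti a (i - 1) (by omega)
        have : 0 < i := by omega
        rcases h2 with h2 | h2 <;> omega
      · rw [YoungDiagram.mem_iff_lt_rowLen]; omega
  have hmem' : ∀ c : ℕ × ℕ, c ∈ outsideCells l ↔ c.2 + 1 = l.rowLen c.1 ∧
      l.rowLen (c.1 + 1) < l.rowLen c.1 := by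
    rintro ⟨i, j⟩
    simp only [outsideCells, mem_filter, YoungDiagram.mem_cells, YoungDiagram.mem_iff_lt_rowLen]
    omega
  have h0 : (0, l.rowLen 0) ∈ insideCells l := (hmem _).2 ⟨rfl, Or.inl rfl⟩
  rw [← card_erase_add_one h0]
  congr 1
  symm
  refine card_bij (fun c _ => (c.1 + 1, l.rowLen (c.1 + 1))) ?_ ?_ ?_
  · rintro c hc
    rw [hmem'] at hc
    refine mem_erase.2 ⟨fun h => by simp at h, (hmem _).2 ⟨rfl, Or.inr ?_⟩⟩
    simpa using hc.2
  · rintro ⟨i, j⟩ hc ⟨i', j'⟩ hc' h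
    rw [hmem'] at hc hc'
    simp only [Prod.mk.injEq] at h hc hc'
    obtain rfl : i = i' := by omega
    exact Prod.ext rfl (by simp only; omega)
  · rintro ⟨i, j⟩ hc
    obtain ⟨hc0, hc⟩ := mem_erase.1 hc
    rw [hmem] at hc
    simp only at hc
    have hi : i ≠ 0 := by
      rintro rfl
      exact hc0 (Prod.ext rfl hc.1)
    obtain ⟨i, rfl⟩ := Nat.exists_eq_succ_of_ne_zero hi
    simp only [Nat.succ_eq_add_one, Nat.add_sub_cancel, Nat.add_eq_zero_iff, one_ne_zero,
      and_false, false_or] at hc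
    refine ⟨(i, l.rowLen i - 1), (hmem' _).2 ⟨?_, hc.2⟩, ?_⟩
    · simp only; omega
    · exact Prod.ext rfl hc.1.symm

/-- The moment generating series of the transition measure is
`𝓜_λ(z) = ∏_y (z - y) / ∏_x (z - x)`; this is written here in the variable `w = 1 / z`. -/
theorem momentSeries_mul_prod (l : YoungDiagram) :
    momentSeries l * ∏ c ∈ insideCells l, (1 - PowerSeries.C (swContent c) * PowerSeries.X) =
      ∏ d ∈ outsideCells l, (1 - PowerSeries.C (neContent d) * PowerSeries.X) := by
  classical
  -- the Lagrange interpolation formula for `∏_y (z - y)` at the contents of the inside corners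
  have hlag : ∀ z : Coef, ∏ d ∈ outsideCells l, (z - neContent d) =
      ∑ c ∈ insideCells l, transitionMass l c * ∏ d ∈ (insideCells l).erase c,
        (z - swContent d) := by
    intro z
    have h1 := Lagrange.eq_interpolate (s := insideCells l) (v := swContent)
      (f := Lagrange.nodal (outsideCells l) neContent) swContent_injective.injOn (by
        rw [Lagrange.degree_nodal, card_insideCells]
        exact_mod_cast Nat.lt_succ_self _)
    have h2 := congrArg (Polynomial.eval z) h1
    rw [Lagrange.eval_nodal] at h2
    rw [h2, Lagrange.interpolate_apply, Polynomial.eval_finsetSum]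
    refine sum_congr rfl fun c hc => ?_
    rw [Polynomial.eval_mul, Polynomial.eval_C, Lagrange.eval_nodal,
      Lagrange.basis_eq_prod_sub_inv_mul_nodal_div hc, ← Lagrange.nodal_erase_eq_nodal_div hc,
      Polynomial.eval_mul, Polynomial.eval_C, Lagrange.eval_nodal, Lagrange.nodalWeight,
      transitionMass, prod_inv_distrib]
    ring
  -- the same identity in the variable `w = 1 / z`
  have hpoly : (∏ d ∈ outsideCells l, (1 - Polynomial.C (neContent d) * Polynomial.X) :
      Polynomial Coef) = ∑ c ∈ insideCells l, Polynomial.C (transitionMass l c) *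
        ∏ d ∈ (insideCells l).erase c, (1 - Polynomial.C (swContent d) * Polynomial.X) := by
    refine Polynomial.eq_of_infinite_eval_eq _ _ (Set.Infinite.mono (s := {0}ᶜ) ?_
      (Set.finite_singleton (0 : Coef)).infinite_compl)
    intro w hw
    have hw : w ≠ 0 := hw
    have hone : ∀ x : Coef, 1 - x * w = w * (w⁻¹ - x) := fun x => by
      field_simp
    simp only [Set.mem_ofPred_eq, Polynomial.eval_prod, Polynomial.eval_finsetSum,
      Polynomial.eval_mul, Polynomial.eval_sub, Polynomial.eval_one, Polynomial.eval_C,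
      Polynomial.eval_X, hone, prod_mul_distrib, prod_const]
    rw [hlag, mul_sum]
    refine sum_congr rfl fun c hc => ?_
    rw [card_erase_of_mem hc, card_insideCells, Nat.add_sub_cancel]
    ring
  have hser := congrArg (Polynomial.coeToPowerSeries.ringHom (R := Coef)) hpoly
  simp only [map_prod, map_sum, map_sub, map_mul, map_one,
    Polynomial.coeToPowerSeries.ringHom_apply, Polynomial.coe_C, Polynomial.coe_X] at hser
  rw [hser]
  have hgeom : ∀ x : Coef, PowerSeries.mk (fun k => x ^ k) *
      (1 - PowerSeries.C x * PowerSeries.X) = 1 := by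
    intro x
    ext n
    rw [mul_sub, mul_one, ← mul_assoc, map_sub, mul_comm _ (PowerSeries.C x), mul_assoc,
      PowerSeries.coeff_C_mul]
    cases n with
    | zero => simp
    | succ n => simp [PowerSeries.coeff_succ_mul_X, PowerSeries.coeff_one, pow_succ']
  have hmom : momentSeries l = ∑ c ∈ insideCells l,
      PowerSeries.C (transitionMass l c) * PowerSeries.mk (fun k => swContent c ^ k) := by
    ext n
    simp [momentSeries, moment, PowerSeries.coeff_C_mul]
  rw [hmom, sum_mul]
  refine sum_congr rfl fun c hc => ?_
  rw [← mul_prod_erase _ _ hc, mul_assoc, ← mul_assoc (PowerSeries.mk _), hgeom, one_mul]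

/-- The transition measure has total mass `1`. -/
theorem constantCoeff_momentSeries (l : YoungDiagram) :
    PowerSeries.constantCoeff (momentSeries l) = 1 := by
  have h := congrArg PowerSeries.constantCoeff (momentSeries_mul_prod l)
  simpa [map_prod] using h

/-! ### Boolean and free cumulants -/

/-- The Boolean cumulant `B_k(λ)`, `k ≥ 1`, defined by `1 / 𝓜_λ(z) = z - ∑_{k ≥ 1} B_k(λ) z^{1-k}`,
that is, by `(∑_k M_k(λ) w^k)⁻¹ = 1 - ∑_{k ≥ 1} B_k(λ) w^k` with `w = 1 / z`. -/
def booleanCumulant (l : YoungDiagram) (k : ℕ) : Coef :=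
  - PowerSeries.coeff k (momentSeries l)⁻¹

/-- The series `𝓜_λ(z) = ∑_k M_k(λ) w^{k+1}`, in the variable `w = 1 / z`. -/
def cauchySeries (l : YoungDiagram) : PowerSeries Coef := PowerSeries.X * momentSeries l

theorem isUnit_coeff_one_cauchySeries (l : YoungDiagram) :
    IsUnit (PowerSeries.coeff 1 (cauchySeries l)) := by
  have h : PowerSeries.coeff 1 (cauchySeries l) = 1 := by
    rw [cauchySeries, show (1 : ℕ) = 0 + 1 from rfl, PowerSeries.coeff_succ_X_mul,
      PowerSeries.coeff_zero_eq_constantCoeff_apply, constantCoeff_momentSeries]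
  rw [h]
  exact isUnit_one

/-- The compositional inverse `w = w(u)` of the power series `u = 𝓜_λ(1 / w)`.  In terms of the
compositional inverse `𝓡_λ(u)` of `𝓜_λ(z)` one has `w(u) = 1 / 𝓡_λ(u)`. -/
def cauchySeriesInv (l : YoungDiagram) : PowerSeries Coef :=
  (cauchySeries l).substInvOfIsUnit (isUnit_coeff_one_cauchySeries l)

/-- The free cumulant `R_k(λ)`, `k ≥ 1`, defined by `𝓡_λ(u) = u⁻¹ + ∑_{k ≥ 1} R_k(λ) u^{k-1}`, that
is, by `(w(u) / u)⁻¹ = u 𝓡_λ(u) = 1 + ∑_{k ≥ 1} R_k(λ) u^k`. -/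
def freeCumulant (l : YoungDiagram) (k : ℕ) : Coef :=
  PowerSeries.coeff k
    (PowerSeries.mk fun n => PowerSeries.coeff (n + 1) (cauchySeriesInv l))⁻¹

end AnisotropicYoung

end

/-! In a diagram with N rows, row i ends in a vertical edge whose endpoints have contents y_i + 1/α
and y_i, where y_i = λ_i - i/α. An endpoint shared by two rows of equal length cancels, so the
corners may be replaced by all row endpoints, and ∑ M_k w^k = (1 + N w/α)⁻¹ ∏ (1 - y_i w) / (1 -
(y_i + 1/α) w) (`momentSeries_eq_rowSeries`). The right side is symmetric in the y_i and unchanged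
by an empty row (`rowSeries_snoc`), so its coefficients are shifted symmetric functions. Every 1/α
in it is accompanied by a w, which bounds the degree in 1/α uniformly in N.

Each row contributes 1 + ∑ (1/α)(y_i + 1/α)^k w^{k+1}, a series whose coefficient of w^k, k ≥ 1, has
degree less than k. When such series are multiplied, cross terms lose a further degree, so top
degree parts add up and the leading form of M_{k+2} is p_{k+1}/α.

Moments, Boolean and free cumulants all satisfy [w^k] M = ∑_j K_j [w^{k-j}] M^{e j}, with e j = 0,
1, j respectively. The terms with j < k again lose a degree, so K_{k+2} has the same leading form
p_{k+1}/α in all three cases (`IsSubmonic.cumulant`).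

A family with these leading forms is an algebraic basis. Independence follows from that of p_1, …,
p_n in n variables (`algebraicIndependent_of_leading`). Generation is an induction on the degree
(`adjoin_eq_top_of_leading`), where the degree D part of a shifted symmetric function is controlled
by its D-variable component (`component_mem_degreeLT`). -/

noncomputable section

namespace AnisotropicYoung

open Finset

/-! ### Degree filtration and power sums in finitely many variables -/

section SymmetricFunctions

open MvPolynomial

variable {K : Type*} [Field K]

/-- The polynomials all of whose monomials have degree less than `D`. -/
def degreeLT (σ K : Type*) [Field K] (D : ℕ) : Submodule K (MvPolynomial σ K) where
  carrier := {p | ∀ m : σ →₀ ℕ, D ≤ m.degree → coeff m p = 0}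
  zero_mem' := fun m _ => coeff_zero m
  add_mem' := fun hp hq m hm => by rw [coeff_add, hp m hm, hq m hm, add_zero]
  smul_mem' := fun c p hp m hm => by rw [coeff_smul, hp m hm, smul_zero]

variable {σ : Type*} {D E : ℕ} {p q : MvPolynomial σ K}

theorem degreeLT_mono (h : D ≤ E) : degreeLT σ K D ≤ degreeLT σ K E :=
  fun _ hp m hm => hp m (h.trans hm)

/-- The strict bound lets induction on the degree start from the zero polynomial. -/
theorem degreeLT_zero : degreeLT σ K 0 = ⊥ :=
  eq_bot_iff.2 fun p hp => by
    rw [Submodule.mem_bot]; ext m; rw [hp m (Nat.zero_le _), coeff_zero]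

/-- A drop below the expected degree in one factor persists in the product; this is how all error
terms are discarded. -/
theorem mul_mem_degreeLT (hp : p ∈ degreeLT σ K D) (hq : q ∈ degreeLT σ K (E + 1)) :
    p * q ∈ degreeLT σ K (D + E) := by
  classical
  intro m hm
  rw [coeff_mul]
  refine sum_eq_zero fun x hx => ?_
  rw [HasAntidiagonal.mem_antidiagonal] at hx
  rw [← hx, map_add] at hm
  rcases le_or_gt D x.1.degree with h | h
  · rw [hp _ h, zero_mul]
  · rw [hq _ (by omega), mul_zero]

theorem totalDegree_le_iff_mem_degreeLT : p.totalDegree ≤ D ↔ p ∈ degreeLT σ K (D + 1) := by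
  constructor
  · intro h m hm
    by_contra hc
    have := le_totalDegree (mem_support_iff.2 hc)
    rw [Finsupp.degree_apply] at hm
    simp only [Finsupp.sum] at this
    omega
  · intro h
    rw [totalDegree, Finset.sup_le_iff]
    intro m hm
    by_contra hc
    refine mem_support_iff.1 hm (h m ?_)
    rw [Finsupp.degree_apply]
    simp only [Finsupp.sum] at hc
    omega

theorem isHomogeneous_mem_degreeLT (hp : p.IsHomogeneous D) : p ∈ degreeLT σ K (D + 1) :=
  fun _ hm => hp.coeff_eq_zero (by omega)

theorem sub_homogeneousComponent_mem_degreeLT (hp : p ∈ degreeLT σ K (D + 1)) :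
    p - homogeneousComponent D p ∈ degreeLT σ K D := by
  intro m hm
  rw [coeff_sub, coeff_homogeneousComponent]
  split_ifs with h
  · rw [sub_self]
  · rw [hp m (by omega), sub_zero]

theorem C_mem_degreeLT (c : K) : (C c : MvPolynomial σ K) ∈ degreeLT σ K 1 :=
  isHomogeneous_mem_degreeLT (isHomogeneous_C σ c)

/-- A surjective endomorphism of a Noetherian ring is injective. -/
theorem injective_of_surjective_endomorphism {R : Type*} [CommRing R] [IsNoetherianRing R]
    (f : R →+* R) (hf : Function.Surjective f) : Function.Injective f := by
  -- The kernels of the iterates stabilise, say at n. Writing x = fⁿ y, the equation f x = 0 puts y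
  -- in ker fⁿ⁺¹ = ker fⁿ, so x = 0.
  have hmono : Monotone fun n => RingHom.ker (f ^ n) := monotone_nat_of_le_succ fun n x hx => by
    simp only [RingHom.mem_ker, RingHom.coe_pow] at hx ⊢
    rw [Function.iterate_succ_apply', hx, map_zero]
  obtain ⟨n, hn⟩ := monotone_stabilizes_iff_noetherian.2 ‹IsNoetherianRing R› ⟨_, hmono⟩
  rw [injective_iff_map_eq_zero]
  intro x hx
  obtain ⟨y, rfl⟩ := hf.iterate n x
  have h1 : y ∈ RingHom.ker (f ^ (n + 1)) := by
    rwa [RingHom.mem_ker, RingHom.coe_pow, Function.iterate_succ_apply']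
  have h2 := hn (n + 1) n.le_succ
  simp only [OrderHom.coe_mk] at h2
  rw [← h2, RingHom.mem_ker, RingHom.coe_pow] at h1
  exact h1

/-- The multiples `c p₁, …, c p_N` of the power sums in `N` variables. -/
def scaledPsum (c : K) (N k : ℕ) : MvPolynomial (Fin N) K := C c * psum (Fin N) K (k + 1)

theorem isHomogeneous_scaledPsum (c : K) (N k : ℕ) : (scaledPsum c N k).IsHomogeneous (k + 1) :=
  IsHomogeneous.C_mul (IsHomogeneous.sum _ _ _ fun i _ => isHomogeneous_X_pow i _) c

/-- Newton's identities express k e_k through power sums and earlier e_i. Dividing by k recovers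
every e_k in characteristic zero, and the e_k generate the symmetric polynomials. -/
theorem exists_aeval_scaledPsum [CharZero K] {c : K} (hc : c ≠ 0) {N : ℕ}
    {q : MvPolynomial (Fin N) K} (hq : q.IsSymmetric) :
    ∃ H : MvPolynomial (Fin N) K, aeval (fun i : Fin N => scaledPsum c N i) H = q := by
  let A := (aeval (R := K) fun i : Fin N => scaledPsum c N i).range
  have hpsum : ∀ k, 0 < k → k ≤ N → psum (Fin N) K k ∈ A := by
    intro k h0 hk
    refine ⟨C c⁻¹ * X ⟨k - 1, by omega⟩, ?_⟩
    simp only [AlgHom.toRingHom_eq_coe, RingHom.coe_coe, map_mul, aeval_C, aeval_X, scaledPsum,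
      algebraMap_eq]
    rw [← mul_assoc, ← C_mul, inv_mul_cancel₀ hc, C_1, one_mul, Nat.sub_add_cancel h0]
  have hesymm : ∀ k, k ≤ N → esymm (Fin N) K k ∈ A := by
    intro k
    induction k using Nat.strong_induction_on with
    | _ k ih =>
    intro hk
    rcases Nat.eq_zero_or_pos k with rfl | h0
    · rw [esymm_zero]; exact A.one_mem
    have h := mul_esymm_eq_sum (Fin N) K k
    have h1 : esymm (Fin N) K k = (k : K)⁻¹ •
        ((k : MvPolynomial (Fin N) K) * esymm (Fin N) K k) := by
      rw [← nsmul_eq_mul, ← Nat.cast_smul_eq_nsmul K, smul_smul, inv_mul_cancel₀, one_smul]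
      exact_mod_cast h0.ne'
    rw [h1, h]
    refine A.smul_mem (A.mul_mem (A.pow_mem (A.neg_mem A.one_mem) _) (A.sum_mem fun a ha => ?_)) _
    rw [mem_filter, HasAntidiagonal.mem_antidiagonal] at ha
    exact A.mul_mem (A.mul_mem (A.pow_mem (A.neg_mem A.one_mem) _) (ih _ ha.2 (by omega)))
      (hpsum _ (by omega) (by omega))
  obtain ⟨H, hH⟩ := esymmAlgHom_surjective (σ := Fin N) K (n := N) (by simp) ⟨q, hq⟩
  have h2 := esymmAlgHom_apply (σ := Fin N) (R := K) H
  rw [hH] at h2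
  have : q ∈ A := by
    change q = _ at h2
    have h3 : aeval (fun i : Fin N => esymm (Fin N) K (i + 1)) H ∈
        (aeval (R := K) fun i : Fin N => esymm (Fin N) K (i + 1)).range := ⟨H, rfl⟩
    rw [← Algebra.adjoin_range_eq_range_aeval] at h3
    rw [h2]
    refine Algebra.adjoin_le ?_ h3
    rintro _ ⟨i, rfl⟩
    exact hesymm _ i.2
  exact this

/-- The scaled power sums give a surjection onto the symmetric polynomials, which form a polynomial
ring in the N elementary ones. Composed with that isomorphism it is a surjective endomorphism of a
Noetherian ring, hence injective. -/
theorem scaledPsum_injective [CharZero K] {c : K} (hc : c ≠ 0) (N : ℕ) :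
    Function.Injective (aeval (R := K) fun i : Fin N => scaledPsum c N i) := by
  let φ : MvPolynomial (Fin N) K →ₐ[K] symmetricSubalgebra (Fin N) K :=
    aeval fun i => ⟨scaledPsum c N i,
      (IsSymmetric.C c).mul (psum_isSymmetric (Fin N) K _)⟩
  have hφ : ∀ H, (φ H : MvPolynomial (Fin N) K) = aeval (fun i : Fin N => scaledPsum c N i) H :=
    fun H => (Subalgebra.mvPolynomial_aeval_coe _ _ _).symm
  have hs : Function.Surjective φ := by
    rintro ⟨q, hq⟩
    obtain ⟨H, hH⟩ := exists_aeval_scaledPsum hc hq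
    exact ⟨H, Subtype.ext ((hφ H).trans hH)⟩
  let e := esymmAlgEquiv (Fin N) K (n := N) (by simp)
  have hinj := injective_of_surjective_endomorphism
    (e.symm.toAlgHom.comp φ).toRingHom (e.symm.surjective.comp hs)
  intro H H' h
  rw [← hφ, ← hφ] at h
  apply hinj
  simp [Subtype.ext h]

/-! ### Leading forms under substitution -/

section LeadingForms

variable {ι : Type*} {w : ι → ℕ} {y τ : ι → MvPolynomial σ K}

/-- Leading forms multiply: a'b' - ab = (a' - a) b' + (b' - b) a, and both terms have lower degree.
-/
theorem aeval_monomial_leading (hτ : ∀ i, (τ i).IsHomogeneous (w i))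
    (hy : ∀ i, y i - τ i ∈ degreeLT σ K (w i)) (m : ι →₀ ℕ) :
    (aeval τ (monomial m (1 : K))).IsHomogeneous (Finsupp.weight w m) ∧
      aeval y (monomial m (1 : K)) - aeval τ (monomial m (1 : K)) ∈
        degreeLT σ K (Finsupp.weight w m) := by
  have hadd : ∀ a b : ι →₀ ℕ, monomial (a + b) (1 : K) = monomial a 1 * monomial b 1 := by
    intro a b; rw [monomial_mul, one_mul]
  have step : ∀ (a b : MvPolynomial σ K) (a' b' : MvPolynomial σ K) (i j : ℕ),
      (a.IsHomogeneous i ∧ a' - a ∈ degreeLT σ K i) →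
      (b.IsHomogeneous j ∧ b' - b ∈ degreeLT σ K j) →
      ((a * b).IsHomogeneous (i + j) ∧ a' * b' - a * b ∈ degreeLT σ K (i + j)) := by
    rintro a b a' b' i j ⟨ha, ha'⟩ ⟨hb, hb'⟩
    refine ⟨ha.mul hb, ?_⟩
    have h1 : b' ∈ degreeLT σ K (j + 1) := by
      rw [← sub_add_cancel b' b]
      exact Submodule.add_mem _ (degreeLT_mono j.le_succ hb') (isHomogeneous_mem_degreeLT hb)
    have h2 : a' * b' - a * b = (a' - a) * b' + (b' - b) * a := by ring
    rw [h2]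
    refine Submodule.add_mem _ (mul_mem_degreeLT ha' h1) ?_
    rw [add_comm]
    exact mul_mem_degreeLT hb' (isHomogeneous_mem_degreeLT ha)
  induction m using Finsupp.induction_linear with
  | zero =>
    simp only [map_zero, monomial_zero', map_one, sub_self, Submodule.zero_mem, and_true]
    exact isHomogeneous_one σ K
  | add a b ha hb =>
    rw [hadd, map_mul, map_mul, map_add]
    exact step _ _ _ _ _ _ ha hb
  | single i n =>
    induction n with
    | zero =>
      simp only [Finsupp.single_zero, map_zero, monomial_zero', map_one, sub_self,
        Submodule.zero_mem, and_true]
      exact isHomogeneous_one σ K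
    | succ n ih =>
      rw [Finsupp.single_add, hadd, map_mul, map_mul, map_add]
      refine step _ _ _ _ _ _ ih ?_
      rw [show monomial (Finsupp.single i 1) (1 : K) = X i from rfl, aeval_X, aeval_X,
        Finsupp.weight_single, one_smul]
      exact ⟨hτ i, hy i⟩

/-- Substituting homogeneous τ_i of degree w_i turns the weight grading into the degree grading, as
one sees on monomials. -/
theorem homogeneousComponent_aeval (hτ : ∀ i, (τ i).IsHomogeneous (w i)) (D : ℕ)
    (H : MvPolynomial ι K) :
    homogeneousComponent D (aeval τ H) = aeval τ (weightedHomogeneousComponent w D H) := by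
  have h : (homogeneousComponent D).comp (aeval τ).toLinearMap =
      (aeval τ).toLinearMap.comp (weightedHomogeneousComponent (R := K) w D) := by
    refine MvPolynomial.linearMap_ext fun m => LinearMap.ext_ring ?_
    have h1 := (aeval_monomial_leading (y := τ) hτ (fun i => by simp) m).1
    simp only [LinearMap.comp_apply, AlgHom.toLinearMap_apply]
    rw [weightedHomogeneousComponent_of_mem (isWeightedHomogeneous_monomial w m 1 rfl),
      homogeneousComponent_of_mem h1]
    split_ifs <;> simp_all
  exact LinearMap.congr_fun h H

theorem aeval_sub_aeval_mem_degreeLT (hτ : ∀ i, (τ i).IsHomogeneous (w i))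
    (hy : ∀ i, y i - τ i ∈ degreeLT σ K (w i)) {D : ℕ} {H : MvPolynomial ι K}
    (hH : ∀ m ∈ H.support, Finsupp.weight w m ≤ D) :
    aeval y H - aeval τ H ∈ degreeLT σ K D := by
  rw [H.as_sum, map_sum, map_sum, ← sum_sub_distrib]
  refine Submodule.sum_mem _ fun m hm => ?_
  have h : monomial m (coeff m H) = (coeff m H) • monomial m (1 : K) := by
    rw [smul_monomial, smul_eq_mul, mul_one]
  rw [h, map_smul, map_smul, ← smul_sub]
  exact Submodule.smul_mem _ _
    (degreeLT_mono (hH m hm) (aeval_monomial_leading hτ hy m).2)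

end LeadingForms

/-! ### Translation of the variables -/

section Shift

/-- Replacing `x_i` by `x_i - a_i` does not change the leading form. -/
theorem aeval_X_sub_C_sub_mem_degreeLT (a : σ → K) {D : ℕ} (hp : p ∈ degreeLT σ K (D + 1)) :
    aeval (fun i => X i - C (a i)) p - p ∈ degreeLT σ K D := by
  have h := aeval_sub_aeval_mem_degreeLT (w := 1) (τ := X) (y := fun i => X i - C (a i)) (D := D)
    (H := p) (fun i => isHomogeneous_X K i)
    (fun i => by
      rw [sub_sub_cancel_left]
      exact Submodule.neg_mem _ (C_mem_degreeLT (a i))) (fun m hm => by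
      change Finsupp.weight (fun _ => 1) m ≤ D
      rw [← Finsupp.degree_eq_weight_one]
      by_contra hc
      exact mem_support_iff.1 hm (hp m (by omega)))
  rwa [aeval_X_left_apply] at h

/-- Since p and its translate share their leading form, any excess degree of p can be lowered one
step at a time until it meets the bound on the translate. -/
theorem mem_degreeLT_of_aeval_X_sub_C (a : σ → K) {D : ℕ}
    (h : aeval (fun i => X i - C (a i)) p ∈ degreeLT σ K D) : p ∈ degreeLT σ K D := by
  have key : ∀ E, p ∈ degreeLT σ K (D + E) → p ∈ degreeLT σ K D := by
    intro E
    induction E with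
    | zero => exact id
    | succ E ih =>
      intro hE
      refine ih ?_
      have h1 := aeval_X_sub_C_sub_mem_degreeLT a (D := D + E) hE
      have h2 := Submodule.sub_mem _ (degreeLT_mono (Nat.le_add_right D E) h) h1
      rwa [sub_sub_cancel] at h2
  refine key (p.totalDegree + 1) (degreeLT_mono (by omega)
    (totalDegree_le_iff_mem_degreeLT.1 le_rfl))

end Shift

end SymmetricFunctions

/-! ### Families with power sum leading forms are algebraic bases -/

section Basis

open MvPolynomial

/-- The `N`-variable component of a shifted symmetric function. -/
def component (N : ℕ) : ShiftedSym →ₐ[Coef] MvPolynomial (Fin N) Coef :=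
  (Pi.evalAlgHom Coef (fun N : ℕ => MvPolynomial (Fin N) Coef) N).comp ShiftedSym.val

theorem component_apply (N : ℕ) (f : ShiftedSym) : component N f = f.1 N := rfl

theorem coeff_setLastZero {N : ℕ} (p : MvPolynomial (Fin (N + 1)) Coef) (m : Fin N →₀ ℕ) :
    coeff m (setLastZero N p) = coeff (m.mapDomain Fin.castSucc) p := by
  have h : (lcoeff Coef m).comp (setLastZero N).toLinearMap =
      lcoeff Coef (m.mapDomain Fin.castSucc) := by
    refine MvPolynomial.linearMap_ext fun u => LinearMap.ext_ring ?_
    simp only [LinearMap.comp_apply, AlgHom.toLinearMap_apply, lcoeff_apply, setLastZero,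
      aeval_monomial, map_one, one_mul]
    rw [Finsupp.prod_fintype _ _ (fun _ => pow_zero _), Fin.prod_univ_castSucc]
    simp only [Fin.snoc_castSucc, Fin.snoc_last]
    have hu : ∏ i : Fin N, (X i : MvPolynomial (Fin N) Coef) ^ u i.castSucc =
        monomial (Finsupp.equivFunOnFinite.symm fun i => u i.castSucc) 1 := by
      rw [monomial_eq, map_one, one_mul, Finsupp.prod_fintype _ _ (fun _ => pow_zero _)]
      rfl
    rw [hu, coeff_monomial]
    by_cases h0 : u (Fin.last N) = 0
    · rw [h0, pow_zero, mul_one, coeff_monomial]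
      refine if_congr ?_ rfl rfl
      constructor
      · rintro rfl
        ext i
        refine Fin.lastCases ?_ (fun j => ?_) i
        · rw [h0, Finsupp.mapDomain_of_notMem_range]
          rintro ⟨j, hj⟩
          exact (Fin.castSucc_lt_last j).ne hj
        · rw [Finsupp.mapDomain_apply (Fin.castSucc_injective N)]
          rfl
      · rintro rfl
        ext i
        exact Finsupp.mapDomain_apply (Fin.castSucc_injective N) _ _
    · rw [zero_pow h0, mul_zero, coeff_zero, if_neg]
      rintro rfl
      refine h0 (Finsupp.mapDomain_of_notMem_range _ _ ?_)
      rintro ⟨j, hj⟩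
      exact (Fin.castSucc_lt_last j).ne hj
  exact LinearMap.congr_fun h p

theorem setLastZero_mem_degreeLT {N D : ℕ} {p : MvPolynomial (Fin (N + 1)) Coef}
    (hp : p ∈ degreeLT (Fin (N + 1)) Coef D) : setLastZero N p ∈ degreeLT (Fin N) Coef D :=
  fun m hm => by rw [coeff_setLastZero, hp _ (by rwa [Finsupp.degree_mapDomain])]

/-- The leading form of a shifted symmetric polynomial is symmetric. -/
theorem IsShiftedSymmetric.exists_isSymmetric {N D : ℕ} {p : MvPolynomial (Fin N) Coef}
    (hp : IsShiftedSymmetric p) (hD : p ∈ degreeLT (Fin N) Coef (D + 1)) :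
    ∃ q : MvPolynomial (Fin N) Coef, q.IsSymmetric ∧ q ∈ degreeLT (Fin N) Coef (D + 1) ∧
      p - q ∈ degreeLT (Fin N) Coef D := by
  obtain ⟨q, hq, rfl⟩ := hp
  have h := mem_degreeLT_of_aeval_X_sub_C _ hD
  exact ⟨q, hq, h, aeval_X_sub_C_sub_mem_degreeLT _ h⟩

/-- A monomial of degree D ≤ N in N + 1 variables omits one of them. By symmetry of the leading form
the omitted variable may be taken to be the last, and then the coefficient is still visible after
x_{N+1} = 0. -/
theorem IsShiftedSymmetric.mem_degreeLT_of_setLastZero {N D : ℕ} (hN : D ≤ N)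
    {p : MvPolynomial (Fin (N + 1)) Coef} (hp : IsShiftedSymmetric p)
    (hD : p ∈ degreeLT (Fin (N + 1)) Coef (D + 1))
    (h0 : setLastZero N p ∈ degreeLT (Fin N) Coef D) : p ∈ degreeLT (Fin (N + 1)) Coef D := by
  obtain ⟨q, hq, hqD, hpq⟩ := hp.exists_isSymmetric hD
  suffices h : q ∈ degreeLT (Fin (N + 1)) Coef D by
    rw [← sub_add_cancel p q]
    exact Submodule.add_mem _ hpq h
  intro m hm
  rcases hm.lt_or_eq with hlt | heq
  · exact hqD m hlt
  -- N + 1 positive exponents would sum to more than D.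
  obtain ⟨i, hi⟩ : ∃ i, m i = 0 := by
    by_contra! hc
    have h1 : ∑ i : Fin (N + 1), 1 ≤ ∑ i, m i :=
      sum_le_sum fun i _ => Nat.one_le_iff_ne_zero.2 (hc i)
    rw [← Finsupp.degree_eq_sum, ← heq] at h1
    simp at h1
    omega
  let e := Equiv.swap i (Fin.last N)
  have h1 : coeff m q = coeff (m.mapDomain e) q := by
    conv_rhs => rw [← hq e]
    rw [coeff_rename_mapDomain _ e.injective]
  have h2 : (m.mapDomain e) (Fin.last N) = 0 := by
    have : Fin.last N = e i := (Equiv.swap_apply_left _ _).symm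
    rw [this, Finsupp.mapDomain_apply e.injective, hi]
  obtain ⟨m', hm'⟩ : ∃ m' : Fin N →₀ ℕ, m'.mapDomain Fin.castSucc = m.mapDomain e := by
    refine ⟨_, Finsupp.mapDomain_comapDomain Fin.castSucc (Fin.castSucc_injective N) _ ?_⟩
    intro j hj
    refine Fin.lastCases (fun hj => ?_) (fun k _ => ⟨k, rfl⟩) j hj
    exact absurd h2 (Finsupp.mem_support_iff.1 hj)
  have hdeg : m'.degree = D := by
    rw [← Finsupp.degree_mapDomain Fin.castSucc m', hm', Finsupp.degree_mapDomain, heq]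
  -- Only q is symmetric and only p has a known restriction, but the two agree in degree D.
  have h3 := hpq (m.mapDomain e) (by rw [Finsupp.degree_mapDomain]; exact heq.le)
  rw [coeff_sub, ← hm', ← coeff_setLastZero, h0 _ hdeg.ge, zero_sub, neg_eq_zero, hm'] at h3
  rw [h1, h3]

/-- A shifted symmetric function of degree at most `D` whose `D`-variable component has degree
less than `D` has degree less than `D`. -/
theorem component_mem_degreeLT {D : ℕ} (f : ShiftedSym)
    (hf : ∀ N, component N f ∈ degreeLT (Fin N) Coef (D + 1))
    (h0 : component D f ∈ degreeLT (Fin D) Coef D) (N : ℕ) :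
    component N f ∈ degreeLT (Fin N) Coef D := by
  rcases le_total D N with h | h
  · induction N, h using Nat.le_induction with
    | base => exact h0
    | succ N hN ih =>
      refine (f.2.1 (N + 1)).mem_degreeLT_of_setLastZero hN (hf (N + 1)) ?_
      rw [f.2.2.1]
      exact ih
  · induction h using Nat.decreasingInduction with
    | self => exact h0
    | of_succ N hN ih =>
      rw [component_apply, ← f.2.2.1 N]
      exact setLastZero_mem_degreeLT ih

variable {c : Coef} {y : ℕ → ShiftedSym}

theorem aeval_component {ι : Type*} (N : ℕ) (z : ι → ShiftedSym) (H : MvPolynomial ι Coef) :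
    component N (aeval z H) = aeval (fun i => component N (z i)) H := by
  rw [← AlgHom.comp_apply, comp_aeval]

/-- In a relation H, the part of top weight D, evaluated at the scaled power sums, is the degree D
part of H evaluated at the `y k`, hence zero. Independence of the power sums kills that part, and
the weight descends. -/
theorem algebraicIndependent_of_leading (hc : c ≠ 0)
    (hy : ∀ k N, component N (y k) - scaledPsum c N k ∈ degreeLT (Fin N) Coef (k + 1)) :
    AlgebraicIndependent Coef y := by
  rw [AlgebraicIndependent, injective_iff_map_eq_zero]
  intro H hH
  -- The number of variables is taken equal to the number of power sums involved, where these are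
  -- independent.
  obtain ⟨n, hn⟩ : ∃ n, ∀ k ∈ H.vars, k < n :=
    ⟨H.vars.sup id + 1, fun k hk => Nat.lt_succ_of_le (Finset.le_sup (f := id) hk)⟩
  obtain ⟨H, rfl⟩ := exists_rename_eq_of_vars_subset_range H (Fin.val : Fin n → ℕ)
    Fin.val_injective (fun k hk => ⟨⟨k, hn k hk⟩, rfl⟩)
  rw [aeval_rename] at hH
  have hH' := congrArg (component n) hH
  rw [aeval_component, map_zero] at hH'
  let w : Fin n → ℕ := fun i => i + 1
  have key : ∀ D, (∀ m ∈ H.support, Finsupp.weight w m < D) → H = 0 := by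
    intro D
    induction D with
    | zero =>
      intro h
      by_contra h0
      obtain ⟨m, hm⟩ := support_nonempty.2 h0
      exact Nat.not_lt_zero _ (h m hm)
    | succ D ih =>
      intro h
      have hτ : ∀ i : Fin n, (scaledPsum c n i).IsHomogeneous (w i) :=
        fun i => isHomogeneous_scaledPsum c n i
      have h1 := aeval_sub_aeval_mem_degreeLT hτ (y := fun i : Fin n => component n (y i))
        (fun i => hy i n) (D := D) (H := H) fun m hm => Nat.lt_succ_iff.1 (h m hm)
      have h2 : aeval (fun i : Fin n => scaledPsum c n i) H ∈ degreeLT (Fin n) Coef D := by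
        have h3 : aeval (fun i : Fin n => component n (y i)) H = 0 := hH'
        rw [h3, zero_sub] at h1
        exact (Submodule.neg_mem_iff _).1 h1
      have h4 : weightedHomogeneousComponent w D H = 0 := by
        apply scaledPsum_injective hc n
        rw [map_zero, ← homogeneousComponent_aeval hτ]
        ext m
        rw [coeff_homogeneousComponent, coeff_zero]
        split_ifs with hm
        · exact h2 m hm.ge
        · rfl
      refine ih fun m hm => lt_of_le_of_ne (Nat.lt_succ_iff.1 (h m hm)) fun hw => ?_
      have h5 := congrArg (coeff m) h4
      rw [coeff_weightedHomogeneousComponent, if_pos hw, coeff_zero] at h5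
      exact mem_support_iff.1 hm h5
  rw [key (H.support.sup (Finsupp.weight w) + 1)
    (fun m hm => Nat.lt_succ_of_le (Finset.le_sup (f := Finsupp.weight w) hm)), map_zero]

/-- The leading form of f in D variables is a polynomial in p_1, …, p_D. The same polynomial in the
`y k` gives g with the same leading form there, so f - g has smaller degree in every number of
variables. -/
theorem adjoin_eq_top_of_leading (hc : c ≠ 0)
    (hy : ∀ k N, component N (y k) - scaledPsum c N k ∈ degreeLT (Fin N) Coef (k + 1)) :
    Algebra.adjoin Coef (Set.range y) = ⊤ := by
  have key : ∀ (D : ℕ) (f : ShiftedSym), (∀ N, component N f ∈ degreeLT (Fin N) Coef D) →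
      f ∈ Algebra.adjoin Coef (Set.range y) := by
    intro D
    induction D with
    | zero =>
      intro f hf
      have : f = 0 := Subtype.ext (funext fun N => by
        have := hf N
        rw [degreeLT_zero, Submodule.mem_bot] at this
        exact this)
      rw [this]
      exact Subalgebra.zero_mem _
    | succ D ih =>
      intro f hf
      obtain ⟨q, hq, hqD, hfq⟩ := (f.2.1 D).exists_isSymmetric (hf D)
      have hg : (homogeneousComponent D q).IsSymmetric := fun e => by
        rw [rename_homogeneousComponent, hq e]
      obtain ⟨H, hH⟩ := exists_aeval_scaledPsum hc hg
      let w : Fin D → ℕ := fun i => i + 1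
      have hτ : ∀ N, ∀ i : Fin D, (scaledPsum c N i).IsHomogeneous (w i) :=
        fun N i => isHomogeneous_scaledPsum c N i
      -- Only the weight D part is kept, so that g has degree at most D for every N.
      let H' := weightedHomogeneousComponent w D H
      have hH' : aeval (fun i : Fin D => scaledPsum c D i) H' = homogeneousComponent D q := by
        rw [← homogeneousComponent_aeval (hτ D), hH]
        exact homogeneousComponent_eq_self (homogeneousComponent_isHomogeneous D q)
      let g : ShiftedSym := aeval (fun i : Fin D => y i) H'
      have hgy : ∀ N, component N g - aeval (fun i : Fin D => scaledPsum c N i) H' ∈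
          degreeLT (Fin N) Coef D := by
        intro N
        rw [aeval_component]
        refine aeval_sub_aeval_mem_degreeLT (hτ N) (fun i => hy i N) fun m hm => ?_
        have := mem_support_iff.1 hm
        rw [coeff_weightedHomogeneousComponent] at this
        by_contra hne
        exact this (if_neg (fun h => hne h.le))
      have hgN : ∀ N, component N g ∈ degreeLT (Fin N) Coef (D + 1) := by
        intro N
        rw [← sub_add_cancel (component N g) (aeval (fun i : Fin D => scaledPsum c N i) H')]
        refine Submodule.add_mem _ (degreeLT_mono D.le_succ (hgy N)) (isHomogeneous_mem_degreeLT ?_)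
        rw [← homogeneousComponent_aeval (hτ N)]
        exact homogeneousComponent_isHomogeneous D _
      have hmem : f - g ∈ Algebra.adjoin Coef (Set.range y) := by
        refine ih _ (component_mem_degreeLT _ (fun N => ?_) ?_)
        · rw [map_sub]
          exact Submodule.sub_mem _ (hf N) (hgN N)
        · have h1 := Submodule.sub_mem _
            (Submodule.add_mem _ hfq (sub_homogeneousComponent_mem_degreeLT hqD)) (hgy D)
          rw [hH'] at h1
          rw [map_sub]
          convert h1 using 1
          rw [component_apply D f]
          ring
      have hg' : g ∈ Algebra.adjoin Coef (Set.range y) := by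
        have h3 : g ∈ (aeval (R := Coef) fun i : Fin D => y i).range := ⟨H', rfl⟩
        rw [← Algebra.adjoin_range_eq_range_aeval] at h3
        refine Algebra.adjoin_mono ?_ h3
        rintro _ ⟨i, rfl⟩
        exact ⟨i, rfl⟩
      rw [← sub_add_cancel f g]
      exact Subalgebra.add_mem _ hmem hg'
  rw [eq_top_iff]
  rintro f -
  obtain ⟨D, hD⟩ := f.2.2.2
  exact key (D + 1) f fun N => totalDegree_le_iff_mem_degreeLT.1 (hD N)

end Basis

/-! ### The moment series as a product over rows -/

section MomentSeries

variable {A B : Type*} [CommRing A] [Algebra Coef A] [CommRing B] [Algebra Coef B]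

/-- The geometric series `∑_k a^k w^k`. -/
def geomSeries (a : A) : PowerSeries A := PowerSeries.mk fun k => a ^ k

theorem geomSeries_mul {R : Type*} [CommRing R] (a : R) :
    geomSeries a * (1 - PowerSeries.C a * PowerSeries.X) = 1 := by
  ext n
  rw [mul_sub, mul_one, ← mul_assoc, map_sub, mul_comm _ (PowerSeries.C a), mul_assoc,
    PowerSeries.coeff_C_mul]
  cases n with
  | zero => simp [geomSeries]
  | succ n => simp [geomSeries, PowerSeries.coeff_succ_mul_X, PowerSeries.coeff_one, pow_succ']

/-- The series `(1 - y w) / (1 - (y + 1 / α) w)`, the contribution of a row of the diagram. -/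
def rowFactor (y : A) : PowerSeries A :=
  1 + PowerSeries.C (algebraMap Coef A (1 / α)) *
    (PowerSeries.X * geomSeries (y + algebraMap Coef A (1 / α)))

theorem rowFactor_mul (y : A) :
    rowFactor y * (1 - PowerSeries.C (y + algebraMap Coef A (1 / α)) * PowerSeries.X) =
      1 - PowerSeries.C y * PowerSeries.X := by
  have h := geomSeries_mul (y + algebraMap Coef A (1 / α))
  rw [rowFactor, add_mul, one_mul, mul_assoc, mul_assoc, h, map_add]
  ring

theorem coeff_zero_rowFactor (y : A) : PowerSeries.coeff 0 (rowFactor y) = 1 := by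
  simp [rowFactor]

theorem coeff_succ_rowFactor (y : A) (k : ℕ) : PowerSeries.coeff (k + 1) (rowFactor y) =
    algebraMap Coef A (1 / α) * (y + algebraMap Coef A (1 / α)) ^ k := by
  rw [rowFactor, map_add, PowerSeries.coeff_C_mul, PowerSeries.coeff_succ_X_mul, geomSeries,
    PowerSeries.coeff_mk, PowerSeries.coeff_one, if_neg k.succ_ne_zero, zero_add]

/-- The moment series of a diagram with `N` rows, where `y_i` stands for `λ_i - i / α`. -/
def rowSeries {N : ℕ} (y : Fin N → A) : PowerSeries A :=
  geomSeries (algebraMap Coef A (-(N : Coef) / α)) * ∏ i, rowFactor (y i)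

theorem map_geomSeries (f : A →ₐ[Coef] B) (a : A) :
    PowerSeries.map (f : A →+* B) (geomSeries a) = geomSeries (f a) := by
  ext n
  simp [geomSeries]

theorem map_rowSeries (f : A →ₐ[Coef] B) {N : ℕ} (y : Fin N → A) :
    PowerSeries.map (f : A →+* B) (rowSeries y) = rowSeries fun i => f (y i) := by
  simp only [rowSeries, map_mul, map_prod, map_geomSeries, rowFactor, map_add, map_one,
    PowerSeries.map_C, PowerSeries.map_X, RingHom.coe_coe, AlgHom.commutes]

theorem rowSeries_comp_perm {N : ℕ} (y : Fin N → A) (e : Equiv.Perm (Fin N)) :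
    rowSeries (fun i => y (e i)) = rowSeries y := by
  rw [rowSeries, rowSeries, Equiv.prod_comp e fun i => rowFactor (y i)]

/-- An empty row N + 1 has y = -(N + 1)/α; its factor (1 + (N + 1) w/α) / (1 + N w/α) exactly undoes
the change of the geometric prefactor. This gives stability under x_{N+1} = 0. -/
theorem rowSeries_snoc {N : ℕ} (y : Fin N → A) :
    rowSeries (Fin.snoc (α := fun _ => A) y (algebraMap Coef A (-((N : Coef) + 1) / α))) =
      rowSeries y := by
  rw [rowSeries, rowSeries, Fin.prod_univ_castSucc]
  simp only [Fin.snoc_castSucc, Fin.snoc_last, Nat.cast_add, Nat.cast_one]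
  have h1 := geomSeries_mul (algebraMap Coef A (-((N : Coef) + 1) / α))
  have h2 := rowFactor_mul (algebraMap Coef A (-((N : Coef) + 1) / α))
  have h3 := geomSeries_mul (algebraMap Coef A (-(N : Coef) / α))
  rw [← map_add, show -((N : Coef) + 1) / α + 1 / α = -(N : Coef) / α by ring] at h2
  have h4 : geomSeries (algebraMap Coef A (-((N : Coef) + 1) / α)) *
      rowFactor (algebraMap Coef A (-((N : Coef) + 1) / α)) =
      geomSeries (algebraMap Coef A (-(N : Coef) / α)) := by
    generalize geomSeries (algebraMap Coef A (-((N : Coef) + 1) / α)) = a at *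
    generalize rowFactor (algebraMap Coef A (-((N : Coef) + 1) / α)) = b at *
    generalize geomSeries (algebraMap Coef A (-(N : Coef) / α)) = c at *
    linear_combination (a * c) * h2 - a * b * h3 + c * h1
  rw [← h4]
  ring

theorem rowSeries_mul {N : ℕ} (y : Fin N → A) :
    rowSeries y * ((1 - PowerSeries.C (algebraMap Coef A (-(N : Coef) / α)) * PowerSeries.X) *
      ∏ i, (1 - PowerSeries.C (y i + algebraMap Coef A (1 / α)) * PowerSeries.X)) =
      ∏ i, (1 - PowerSeries.C (y i) * PowerSeries.X) := by
  rw [rowSeries, mul_mul_mul_comm, geomSeries_mul, one_mul, ← prod_mul_distrib]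
  exact prod_congr rfl fun i _ => rowFactor_mul (y i)

end MomentSeries

/-! ### From corners to row endpoints -/

section Corners

theorem mem_insideCells (l : YoungDiagram) (c : ℕ × ℕ) : c ∈ insideCells l ↔
    c.2 = l.rowLen c.1 ∧ (c.1 = 0 ∨ l.rowLen c.1 < l.rowLen (c.1 - 1)) := by
  obtain ⟨i, j⟩ := c
  simp only [insideCells, mem_filter, mem_product, mem_range]
  constructor
  · rintro ⟨-, h1, h2, h3⟩
    rw [YoungDiagram.mem_iff_lt_rowLen] at h1
    have hj : j = l.rowLen i := by
      refine le_antisymm (not_lt.1 fun h => ?_) (not_lt.1 h1)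
      exact lt_irrefl _ (YoungDiagram.mem_iff_lt_rowLen.1 (h3 _ h))
    refine ⟨hj, ?_⟩
    rcases Nat.eq_zero_or_pos i with h | h
    · exact Or.inl h
    · exact Or.inr (hj ▸ YoungDiagram.mem_iff_lt_rowLen.1 (h2 (i - 1) (by omega)))
  · rintro ⟨h1, h2⟩
    have hj : j ≤ l.rowLen 0 := h1 ▸ l.rowLen_anti 0 i (Nat.zero_le i)
    have hi : i ≤ l.colLen 0 := by
      rcases h2 with h2 | h2
      · omega
      · have : (i - 1, 0) ∈ l := YoungDiagram.mem_iff_lt_rowLen.2 (by omega)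
        have := YoungDiagram.mem_iff_lt_colLen.1 this
        omega
    refine ⟨⟨by omega, by omega⟩, ?_, fun a ha => ?_, fun b hb => ?_⟩
    · rw [YoungDiagram.mem_iff_lt_rowLen]; omega
    · rw [YoungDiagram.mem_iff_lt_rowLen]
      have := l.rowLen_anti a (i - 1) (by omega)
      have : 0 < i := by omega
      rcases h2 with h2 | h2 <;> omega
    · rw [YoungDiagram.mem_iff_lt_rowLen]; omega

/-- The rows below which the length of the rows drops. -/
def cornerRows (l : YoungDiagram) : Finset ℕ :=
  (range (l.colLen 0)).filter fun i => l.rowLen (i + 1) < l.rowLen i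

theorem lt_colLen_iff (l : YoungDiagram) (i : ℕ) : i < l.colLen 0 ↔ 0 < l.rowLen i := by
  rw [← YoungDiagram.mem_iff_lt_colLen, ← YoungDiagram.mem_iff_lt_rowLen]

theorem mem_cornerRows (l : YoungDiagram) (i : ℕ) :
    i ∈ cornerRows l ↔ l.rowLen (i + 1) < l.rowLen i := by
  rw [cornerRows, mem_filter, mem_range, lt_colLen_iff]
  omega

theorem insideCells_eq (l : YoungDiagram) : insideCells l =
    insert (0, l.rowLen 0) ((cornerRows l).image fun i => (i + 1, l.rowLen (i + 1))) := by
  ext ⟨i, j⟩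
  simp only [mem_insideCells, mem_insert, mem_image, mem_cornerRows, Prod.mk.injEq]
  constructor
  · rintro ⟨rfl, h⟩
    rcases Nat.eq_zero_or_pos i with rfl | h0
    · exact Or.inl ⟨rfl, rfl⟩
    · obtain ⟨i, rfl⟩ := Nat.exists_eq_succ_of_ne_zero h0.ne'
      simp only [Nat.succ_eq_add_one, Nat.add_sub_cancel] at h ⊢
      exact Or.inr ⟨i, by omega, rfl, rfl⟩
  · rintro (⟨rfl, rfl⟩ | ⟨i, h, rfl, rfl⟩)
    · exact ⟨rfl, Or.inl rfl⟩
    · exact ⟨rfl, Or.inr (by simpa using h)⟩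

theorem outsideCells_eq (l : YoungDiagram) :
    outsideCells l = (cornerRows l).image fun i => (i, l.rowLen i - 1) := by
  ext ⟨i, j⟩
  simp only [outsideCells, mem_filter, YoungDiagram.mem_cells, YoungDiagram.mem_iff_lt_rowLen,
    mem_image, mem_cornerRows, Prod.mk.injEq]
  constructor
  · rintro ⟨h1, h2, h3⟩
    exact ⟨i, by omega, rfl, by omega⟩
  · rintro ⟨i, h, rfl, rfl⟩
    omega

theorem prod_insideCells {M : Type*} [CommMonoid M] (l : YoungDiagram) (g : Coef → M) :
    ∏ c ∈ insideCells l, g (swContent c) = g (content (l.rowLen 0) 0) *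
      ∏ i ∈ cornerRows l, g (content (l.rowLen (i + 1)) (i + 1)) := by
  rw [insideCells_eq, prod_insert, prod_image]
  · rfl
  · intro i _ j _ h
    simpa using (Prod.ext_iff.1 h).1
  · simp

theorem prod_outsideCells {M : Type*} [CommMonoid M] (l : YoungDiagram) (g : Coef → M) :
    ∏ c ∈ outsideCells l, g (neContent c) =
      ∏ i ∈ cornerRows l, g (content (l.rowLen i) (i + 1)) := by
  rw [outsideCells_eq, prod_image]
  · refine prod_congr rfl fun i hi => ?_
    rw [mem_cornerRows] at hi
    simp only [neContent]
    rw [Nat.sub_add_cancel (by omega)]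
  · intro i _ j _ h
    exact (Prod.ext_iff.1 h).1

/-- The corners may be replaced by the endpoints of all the rows, since the contributions of the
other endpoints cancel. -/
theorem prod_outsideCells_mul_prod {M : Type*} [CommMonoid M] (l : YoungDiagram) (g : Coef → M) :
    (∏ c ∈ outsideCells l, g (neContent c)) *
        ∏ i ∈ range (l.colLen 0 + 1), g (content (l.rowLen i) i) =
      (∏ c ∈ insideCells l, g (swContent c)) *
        ∏ i ∈ range (l.colLen 0), g (content (l.rowLen i) (i + 1)) := by
  rw [prod_outsideCells, prod_insideCells, prod_range_succ',
    ← prod_filter_mul_prod_filter_not (range (l.colLen 0))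
      (fun i => l.rowLen (i + 1) < l.rowLen i) (fun i => g (content (l.rowLen (i + 1)) (i + 1))),
    ← prod_filter_mul_prod_filter_not (range (l.colLen 0))
      (fun i => l.rowLen (i + 1) < l.rowLen i) (fun i => g (content (l.rowLen i) (i + 1)))]
  -- Without a drop, the upper endpoint of row i coincides with the lower endpoint of row i + 1.
  have h : ∏ i ∈ range (l.colLen 0) with ¬ l.rowLen (i + 1) < l.rowLen i,
      g (content (l.rowLen (i + 1)) (i + 1)) =
      ∏ i ∈ range (l.colLen 0) with ¬ l.rowLen (i + 1) < l.rowLen i,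
        g (content (l.rowLen i) (i + 1)) := by
    refine prod_congr rfl fun i hi => ?_
    rw [mem_filter] at hi
    have := l.rowLen_anti i (i + 1) i.le_succ
    rw [show l.rowLen (i + 1) = l.rowLen i by omega]
  rw [h]
  change _ * (((∏ i ∈ cornerRows l, _) * _) * _) = _ * ((∏ i ∈ cornerRows l, _) * _)
  ac_rfl

/-- Both sides are quotients of products of factors 1 - x w, over corners and over row endpoints;
the cancellation of endpoints compares them after clearing denominators. -/
theorem momentSeries_eq_rowSeries (l : YoungDiagram) : momentSeries l =
    rowSeries fun i : Fin (l.colLen 0) => (l.rowLen i : Coef) - (((i : ℕ) : Coef) + 1) / α := by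
  let N := l.colLen 0
  let g : Coef → PowerSeries Coef := fun x => 1 - PowerSeries.C x * PowerSeries.X
  have hg : ∀ x, g x ≠ 0 := fun x h => by
    have := congrArg PowerSeries.constantCoeff h
    simp [g] at this
  have h1 := momentSeries_mul_prod l
  have h2 := rowSeries_mul fun i : Fin (l.colLen 0) =>
    (l.rowLen i : Coef) - (((i : ℕ) : Coef) + 1) / α
  have h3 := prod_outsideCells_mul_prod l g
  have hN : l.rowLen N = 0 := by
    have := (lt_colLen_iff l N).not.1 (lt_irrefl _)
    omega
  -- The extra index i = N is the vertex (0, N), which accounts for the geometric prefactor.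
  have h4 : ∏ i ∈ range (N + 1), g (content (l.rowLen i) i) =
      (1 - PowerSeries.C (algebraMap Coef Coef (-(N : Coef) / α)) * PowerSeries.X) *
      ∏ i : Fin N, (1 - PowerSeries.C ((l.rowLen i : Coef) - (((i : ℕ) : Coef) + 1) / α +
        algebraMap Coef Coef (1 / α)) * PowerSeries.X) := by
    rw [prod_range_succ, mul_comm, ← Fin.prod_univ_eq_prod_range
      (fun i => g (content (l.rowLen i) i))]
    congr 1
    · simp only [g, content, hN, Nat.cast_zero, zero_sub, Algebra.algebraMap_self, RingHom.id_apply,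
        neg_div]
    · refine prod_congr rfl fun i _ => ?_
      simp only [g, content, Algebra.algebraMap_self, RingHom.id_apply]
      congr 3
      ring
  have h5 : ∏ i ∈ range N, g (content (l.rowLen i) (i + 1)) =
      ∏ i : Fin N, (1 - PowerSeries.C ((l.rowLen i : Coef) - (((i : ℕ) : Coef) + 1) / α) *
        PowerSeries.X) := by
    rw [← Fin.prod_univ_eq_prod_range (fun i => g (content (l.rowLen i) (i + 1)))]
    simp only [g, content, Nat.cast_add, Nat.cast_one]
  rw [← h4, ← h5] at h2
  have h6 : ∏ i ∈ range (N + 1), g (content (l.rowLen i) i) ≠ 0 :=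
    prod_ne_zero_iff.2 fun i _ => hg _
  have h7 : ∏ c ∈ insideCells l, g (swContent c) ≠ 0 := prod_ne_zero_iff.2 fun i _ => hg _
  refine mul_right_cancel₀ (mul_ne_zero h7 h6) ?_
  change _ * ∏ c ∈ insideCells l, g (swContent c) = ∏ c ∈ outsideCells l, g (neContent c) at h1
  rw [← mul_assoc, h1, h3, ← h2]
  ring

end Corners

/-! ### Power series whose coefficients have submaximal degree -/

section LeadingSeries

open MvPolynomial

variable {σ K : Type*} [Field K]

/-- A power series with constant coefficient `1` whose coefficient of `w^k`, `k ≥ 1`, has degree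
less than `k`. -/
def IsSubmonic (F : PowerSeries (MvPolynomial σ K)) : Prop :=
  PowerSeries.coeff 0 F = 1 ∧ ∀ k, PowerSeries.coeff (k + 1) F ∈ degreeLT σ K (k + 1)

theorem IsSubmonic.one : IsSubmonic (1 : PowerSeries (MvPolynomial σ K)) :=
  ⟨by simp, fun k => by
    rw [PowerSeries.coeff_one, if_neg k.succ_ne_zero]; exact Submodule.zero_mem _⟩

theorem coeff_succ_mul {R : Type*} [CommRing R] (F G : PowerSeries R) (k : ℕ) :
    PowerSeries.coeff (k + 1) (F * G) =
      PowerSeries.coeff 0 F * PowerSeries.coeff (k + 1) G +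
        PowerSeries.coeff (k + 1) F * PowerSeries.coeff 0 G +
        ∑ i ∈ range k, PowerSeries.coeff (i + 1) F * PowerSeries.coeff (k - i) G := by
  rw [PowerSeries.coeff_mul, Finset.Nat.sum_antidiagonal_eq_sum_range_succ_mk, sum_range_succ,
    sum_range_succ', Nat.sub_self, Nat.sub_zero]
  simp only [Nat.add_sub_add_right]
  ring

/-- A cross term F_i G_j with i, j ≥ 1 and i + j = k + 1 has degree at most (i - 1) + (j - 1) < k,
so in degree k the coefficients simply add. -/
theorem IsSubmonic.coeff_mul_sub {F G : PowerSeries (MvPolynomial σ K)} (hF : IsSubmonic F)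
    (hG : IsSubmonic G) (k : ℕ) :
    PowerSeries.coeff (k + 1) (F * G) -
      (PowerSeries.coeff (k + 1) F + PowerSeries.coeff (k + 1) G) ∈ degreeLT σ K k := by
  rw [coeff_succ_mul, hF.1, hG.1, one_mul, mul_one]
  have : ∑ i ∈ range k, PowerSeries.coeff (i + 1) F * PowerSeries.coeff (k - i) G ∈
      degreeLT σ K k := by
    refine Submodule.sum_mem _ fun i hi => ?_
    rw [mem_range] at hi
    obtain ⟨j, hj⟩ : ∃ j, k - i = j + 1 := ⟨k - i - 1, by omega⟩
    have h := mul_mem_degreeLT (hF.2 i) (hG.2 j)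
    rw [hj]
    rwa [show i + 1 + j = k by omega] at h
  convert this using 1
  ring

theorem IsSubmonic.mul {F G : PowerSeries (MvPolynomial σ K)} (hF : IsSubmonic F)
    (hG : IsSubmonic G) : IsSubmonic (F * G) := by
  refine ⟨by rw [PowerSeries.coeff_mul, Finset.Nat.antidiagonal_zero, sum_singleton, hF.1, hG.1,
    one_mul], fun k => ?_⟩
  rw [← sub_add_cancel (PowerSeries.coeff (k + 1) (F * G))
    (PowerSeries.coeff (k + 1) F + PowerSeries.coeff (k + 1) G)]
  exact Submodule.add_mem _ (degreeLT_mono k.le_succ (hF.coeff_mul_sub hG k))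
    (Submodule.add_mem _ (hF.2 k) (hG.2 k))

theorem IsSubmonic.pow {F : PowerSeries (MvPolynomial σ K)} (hF : IsSubmonic F) (n : ℕ) :
    IsSubmonic (F ^ n) := by
  induction n with
  | zero => rw [pow_zero]; exact .one
  | succ n ih => rw [pow_succ]; exact ih.mul hF

theorem IsSubmonic.prod {ι : Type*} (s : Finset ι) {F : ι → PowerSeries (MvPolynomial σ K)}
    (hF : ∀ i, IsSubmonic (F i)) :
    IsSubmonic (∏ i ∈ s, F i) ∧ ∀ k, PowerSeries.coeff (k + 1) (∏ i ∈ s, F i) -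
      ∑ i ∈ s, PowerSeries.coeff (k + 1) (F i) ∈ degreeLT σ K k := by
  classical
  induction s using Finset.induction_on with
  | empty =>
    refine ⟨by rw [prod_empty]; exact .one, fun k => ?_⟩
    rw [prod_empty, sum_empty, sub_zero, PowerSeries.coeff_one, if_neg k.succ_ne_zero]
    exact Submodule.zero_mem _
  | insert a s ha ih =>
    rw [prod_insert ha]
    refine ⟨(hF a).mul ih.1, fun k => ?_⟩
    rw [sum_insert ha]
    convert Submodule.add_mem _ ((hF a).coeff_mul_sub ih.1 k) (ih.2 k) using 1
    ring

end LeadingSeries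

/-! ### Degree in 1/α -/

section InvAlpha

/-- The polynomials of degree at most `D` in `1 / α`. -/
def invAlphaLE (D : ℕ) : Submodule ℚ Coef :=
  (Polynomial.degreeLE ℚ D).map (Polynomial.aeval (1 / α : Coef)).toLinearMap

theorem mem_invAlphaLE {D : ℕ} {x : Coef} :
    x ∈ invAlphaLE D ↔ ∃ p : Polynomial ℚ, p.natDegree ≤ D ∧ x = Polynomial.aeval (1 / α) p := by
  simp only [invAlphaLE, Submodule.mem_map, Polynomial.mem_degreeLE, AlgHom.toLinearMap_apply,
    Polynomial.natDegree_le_iff_degree_le, eq_comm]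

theorem invAlphaLE_mono {D E : ℕ} (h : D ≤ E) : invAlphaLE D ≤ invAlphaLE E := by
  intro x hx
  obtain ⟨p, hp, rfl⟩ := mem_invAlphaLE.1 hx
  exact mem_invAlphaLE.2 ⟨p, hp.trans h, rfl⟩

theorem mul_mem_invAlphaLE {D E : ℕ} {x y : Coef} (hx : x ∈ invAlphaLE D)
    (hy : y ∈ invAlphaLE E) : x * y ∈ invAlphaLE (D + E) := by
  obtain ⟨p, hp, rfl⟩ := mem_invAlphaLE.1 hx
  obtain ⟨q, hq, rfl⟩ := mem_invAlphaLE.1 hy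
  exact mem_invAlphaLE.2 ⟨p * q, Polynomial.natDegree_mul_le_of_le hp hq, by rw [map_mul]⟩

theorem one_mem_invAlphaLE (D : ℕ) : (1 : Coef) ∈ invAlphaLE D :=
  mem_invAlphaLE.2 ⟨1, by simp, by simp⟩

theorem natCast_div_mem_invAlphaLE (n : ℕ) : (n : Coef) / α ∈ invAlphaLE 1 := by
  refine mem_invAlphaLE.2 ⟨(n : Polynomial ℚ) * Polynomial.X, ?_, ?_⟩
  · rw [← nsmul_eq_mul]
    exact (Polynomial.natDegree_smul_le _ _).trans Polynomial.natDegree_X_le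
  · simp [div_eq_mul_inv]

open MvPolynomial

variable {σ : Type*}

/-- The polynomials all of whose coefficients are polynomials of degree at most `D` in `1 / α`. -/
def coeffInvAlphaLE (σ : Type*) (D : ℕ) : AddSubgroup (MvPolynomial σ Coef) where
  carrier := {p | ∀ m, coeff m p ∈ invAlphaLE D}
  zero_mem' := fun m => by rw [coeff_zero]; exact Submodule.zero_mem _
  add_mem' := fun hp hq m => by rw [coeff_add]; exact Submodule.add_mem _ (hp m) (hq m)
  neg_mem' := fun hp m => by rw [coeff_neg]; exact Submodule.neg_mem _ (hp m)

theorem coeffInvAlphaLE_mono {D E : ℕ} (h : D ≤ E) : coeffInvAlphaLE σ D ≤ coeffInvAlphaLE σ E :=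
  fun _ hp m => invAlphaLE_mono h (hp m)

theorem mul_mem_coeffInvAlphaLE {D E : ℕ} {p q : MvPolynomial σ Coef}
    (hp : p ∈ coeffInvAlphaLE σ D) (hq : q ∈ coeffInvAlphaLE σ E) :
    p * q ∈ coeffInvAlphaLE σ (D + E) := by
  classical
  intro m
  rw [coeff_mul]
  exact Submodule.sum_mem _ fun x _ => mul_mem_invAlphaLE (hp _) (hq _)

theorem C_mem_coeffInvAlphaLE {D : ℕ} {x : Coef} (hx : x ∈ invAlphaLE D) :
    (C x : MvPolynomial σ Coef) ∈ coeffInvAlphaLE σ D := by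
  classical
  intro m
  rw [coeff_C]
  split_ifs
  · exact hx
  · exact Submodule.zero_mem _

theorem X_mem_coeffInvAlphaLE (i : σ) (D : ℕ) :
    (X i : MvPolynomial σ Coef) ∈ coeffInvAlphaLE σ D := by
  classical
  intro m
  rw [coeff_X]
  split_ifs
  · exact one_mem_invAlphaLE D
  · exact Submodule.zero_mem _

theorem one_mem_coeffInvAlphaLE (D : ℕ) : (1 : MvPolynomial σ Coef) ∈ coeffInvAlphaLE σ D := by
  rw [← C_1]
  exact C_mem_coeffInvAlphaLE (one_mem_invAlphaLE D)

theorem pow_mem_coeffInvAlphaLE {p : MvPolynomial σ Coef} (hp : p ∈ coeffInvAlphaLE σ 1) (n : ℕ) :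
    p ^ n ∈ coeffInvAlphaLE σ n := by
  induction n with
  | zero => rw [pow_zero]; exact one_mem_coeffInvAlphaLE 0
  | succ n ih => rw [pow_succ]; exact mul_mem_coeffInvAlphaLE ih hp

/-- The multiplicative monoid of the power series whose coefficient of `w^k` has coefficients
of degree at most `k` in `1 / α`. -/
def invAlphaSeries (σ : Type*) : Submonoid (PowerSeries (MvPolynomial σ Coef)) where
  carrier := {F | ∀ k, PowerSeries.coeff k F ∈ coeffInvAlphaLE σ k}
  one_mem' := fun k => by
    rw [PowerSeries.coeff_one]
    split_ifs
    · exact one_mem_coeffInvAlphaLE k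
    · exact AddSubgroup.zero_mem _
  mul_mem' := fun {F G} hF hG k => by
    rw [PowerSeries.coeff_mul]
    refine AddSubgroup.sum_mem _ fun x hx => ?_
    rw [HasAntidiagonal.mem_antidiagonal] at hx
    rw [← hx]
    exact mul_mem_coeffInvAlphaLE (hF _) (hG _)

end InvAlpha

/-! ### The moments as shifted symmetric functions -/

section ShiftedMoments

open MvPolynomial

/-- The shifted variables `x_i - i / α`. -/
def shiftedVar (N : ℕ) (i : Fin N) : MvPolynomial (Fin N) Coef :=
  X i - C (((i : ℕ) + 1 : Coef) / α)

theorem isSubmonic_geomSeries {N : ℕ} (a : Coef) :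
    IsSubmonic (geomSeries (C a : MvPolynomial (Fin N) Coef)) := by
  refine ⟨by simp [geomSeries], fun k => ?_⟩
  rw [geomSeries, PowerSeries.coeff_mk, ← C_pow]
  exact degreeLT_mono (by omega) (C_mem_degreeLT _)

theorem coeff_succ_rowFactor_shiftedVar {N : ℕ} (i : Fin N) (k : ℕ) :
    PowerSeries.coeff (k + 1) (rowFactor (shiftedVar N i)) - C (1 / α) * X i ^ k ∈
      degreeLT (Fin N) Coef k := by
  rw [coeff_succ_rowFactor, algebraMap_eq, ← mul_sub, ← smul_eq_C_mul]
  refine Submodule.smul_mem _ _ ?_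
  -- The base y_i + 1/α of the power is itself a translate of x_i.
  have h := aeval_X_sub_C_sub_mem_degreeLT
    (fun i : Fin N => (((i : ℕ) + 1 : Coef) / α) - 1 / α) (D := k)
    (isHomogeneous_mem_degreeLT (isHomogeneous_X_pow i k))
  rw [map_pow, aeval_X] at h
  convert h using 3
  rw [shiftedVar, C_sub]
  ring

theorem isSubmonic_rowFactor {N : ℕ} (i : Fin N) : IsSubmonic (rowFactor (shiftedVar N i)) := by
  refine ⟨coeff_zero_rowFactor _, fun k => ?_⟩
  rw [← sub_add_cancel (PowerSeries.coeff (k + 1) (rowFactor (shiftedVar N i)))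
    (C (1 / α) * X i ^ k)]
  exact Submodule.add_mem _ (degreeLT_mono k.le_succ (coeff_succ_rowFactor_shiftedVar i k))
    (isHomogeneous_mem_degreeLT (IsHomogeneous.C_mul (isHomogeneous_X_pow i k) _))

theorem isSubmonic_rowSeries (N : ℕ) : IsSubmonic (rowSeries (shiftedVar N)) :=
  (isSubmonic_geomSeries _).mul (IsSubmonic.prod univ isSubmonic_rowFactor).1

/-- The leading form of the moment `M_{k+2}` is `p_{k+1} / α`. -/
theorem coeff_rowSeries_sub_mem_degreeLT (N k : ℕ) :
    PowerSeries.coeff (k + 2) (rowSeries (shiftedVar N)) - scaledPsum (1 / α) N k ∈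
      degreeLT (Fin N) Coef (k + 1) := by
  have h1 := (isSubmonic_geomSeries (N := N) (-(N : Coef) / α)).coeff_mul_sub
    (IsSubmonic.prod univ isSubmonic_rowFactor).1 (k + 1)
  have h2 := (IsSubmonic.prod univ (isSubmonic_rowFactor (N := N))).2 (k + 1)
  -- The geometric prefactor has constant coefficients, invisible in degree k + 1.
  have h3 : PowerSeries.coeff (k + 1 + 1)
      (geomSeries (C (-(N : Coef) / α) : MvPolynomial (Fin N) Coef)) ∈
        degreeLT (Fin N) Coef (k + 1) := by
    rw [geomSeries, PowerSeries.coeff_mk, ← C_pow]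
    exact degreeLT_mono (by omega) (C_mem_degreeLT _)
  have h4 : ∑ i, (PowerSeries.coeff (k + 1 + 1) (rowFactor (shiftedVar N i)) -
      C (1 / α) * X i ^ (k + 1)) ∈ degreeLT (Fin N) Coef (k + 1) :=
    Submodule.sum_mem _ fun i _ => coeff_succ_rowFactor_shiftedVar i (k + 1)
  convert Submodule.add_mem _ (Submodule.add_mem _ h1 h2) (Submodule.add_mem _ h3 h4) using 1
  rw [sum_sub_distrib, scaledPsum, psum, mul_sum]
  change PowerSeries.coeff (k + 2) (geomSeries (C (-(N : Coef) / α)) * _) - _ = _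
  ring

/-- Each 1/α carries a w, so the exponent of w bounds the degree in 1/α. The number N enters only as
a rational coefficient, which makes the bound uniform. -/
theorem rowSeries_mem_invAlphaSeries (N : ℕ) :
    rowSeries (shiftedVar N) ∈ invAlphaSeries (Fin N) := by
  refine Submonoid.mul_mem _ (fun k => ?_) (Submonoid.prod_mem _ fun i _ k => ?_)
  · rw [geomSeries, PowerSeries.coeff_mk]
    refine pow_mem_coeffInvAlphaLE (C_mem_coeffInvAlphaLE ?_) k
    rw [neg_div]
    exact Submodule.neg_mem _ (natCast_div_mem_invAlphaLE N)
  · have h1 : (1 / α : Coef) ∈ invAlphaLE 1 := by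
      simpa using natCast_div_mem_invAlphaLE 1
    cases k with
    | zero => rw [coeff_zero_rowFactor]; exact one_mem_coeffInvAlphaLE 0
    | succ k =>
      rw [coeff_succ_rowFactor, add_comm]
      refine mul_mem_coeffInvAlphaLE (C_mem_coeffInvAlphaLE h1) (pow_mem_coeffInvAlphaLE ?_ k)
      refine AddSubgroup.add_mem _ (AddSubgroup.sub_mem _ (X_mem_coeffInvAlphaLE i 1)
        (C_mem_coeffInvAlphaLE ?_)) (C_mem_coeffInvAlphaLE h1)
      exact_mod_cast natCast_div_mem_invAlphaLE ((i : ℕ) + 1)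

/-- The moment `M_k` as a shifted symmetric function. -/
def shiftedMoment (k : ℕ) : ShiftedSym :=
  ⟨fun N => PowerSeries.coeff k (rowSeries (shiftedVar N)), by
    -- The symmetric polynomial behind the shift is the same coefficient in unshifted variables.
    refine ⟨fun N => ⟨PowerSeries.coeff k (rowSeries X), fun e => ?_, ?_⟩, fun N => ?_, k,
      fun N => ?_⟩
    · have h := map_rowSeries (rename (R := Coef) e) (X : Fin N → MvPolynomial (Fin N) Coef)
      simp only [rename_X] at h
      rw [rowSeries_comp_perm] at h
      conv_rhs => rw [← h]
      rw [PowerSeries.coeff_map]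
      rfl
    · have h := map_rowSeries (aeval (R := Coef) (shiftedVar N))
        (X : Fin N → MvPolynomial (Fin N) Coef)
      simp only [aeval_X] at h
      change PowerSeries.coeff k (rowSeries fun i => shiftedVar N i) = _
      rw [← h, PowerSeries.coeff_map]
      rfl
    · have h := map_rowSeries (setLastZero N) (shiftedVar (N + 1))
      -- Under x_{N+1} = 0 the last shifted variable becomes -(N + 1)/α, the value of an empty row.
      have h2 : (fun i => setLastZero N (shiftedVar (N + 1) i)) =
          Fin.snoc (α := fun _ => MvPolynomial (Fin N) Coef) (shiftedVar N)
            (algebraMap Coef _ (-((N : Coef) + 1) / α)) := by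
        funext i
        refine Fin.lastCases ?_ (fun j => ?_) i
        · simp only [setLastZero, shiftedVar, map_sub, aeval_X, Fin.snoc_last, aeval_C, Fin.val_last,
            zero_sub, neg_div, map_neg]
        · simp only [setLastZero, shiftedVar, map_sub, aeval_X, Fin.snoc_castSucc, aeval_C,
            Fin.val_castSucc, algebraMap_eq]
      rw [h2, rowSeries_snoc] at h
      change _ = PowerSeries.coeff k (rowSeries (shiftedVar N))
      rw [← h, PowerSeries.coeff_map]
      rfl
    · change (PowerSeries.coeff k (rowSeries (shiftedVar N))).totalDegree ≤ k
      cases k with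
      | zero => rw [(isSubmonic_rowSeries N).1]; simp
      | succ k =>
        exact (totalDegree_le_iff_mem_degreeLT.2
          (degreeLT_mono (Nat.le_succ _) ((isSubmonic_rowSeries N).2 k)))⟩

/-- The generating series of the shifted symmetric functions `M_k`. -/
def shiftedMomentSeries : PowerSeries ShiftedSym := PowerSeries.mk shiftedMoment

theorem map_component_shiftedMomentSeries (N : ℕ) :
    PowerSeries.map (component N : ShiftedSym →+* MvPolynomial (Fin N) Coef) shiftedMomentSeries =
      rowSeries (shiftedVar N) := by
  ext1 k
  rw [PowerSeries.coeff_map, shiftedMomentSeries, PowerSeries.coeff_mk]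
  rfl

/-- Evaluation at a partition as a homomorphism of algebras. -/
def evalHom (l : YoungDiagram) : ShiftedSym →ₐ[Coef] Coef :=
  (aeval fun i : Fin (l.colLen 0) => (l.rowLen i : Coef)).comp (component (l.colLen 0))

theorem evalHom_apply (l : YoungDiagram) (f : ShiftedSym) : evalHom l f = evalAt f l := by
  rw [evalHom, AlgHom.comp_apply, evalAt, ← coe_aeval_eq_eval]
  rfl

theorem map_evalHom_shiftedMomentSeries (l : YoungDiagram) :
    PowerSeries.map (evalHom l : ShiftedSym →+* Coef) shiftedMomentSeries = momentSeries l := by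
  have h := map_rowSeries (aeval (R := Coef) fun i : Fin (l.colLen 0) => (l.rowLen i : Coef))
    (shiftedVar (l.colLen 0))
  rw [momentSeries_eq_rowSeries]
  have h2 : (fun i => aeval (R := Coef) (fun i : Fin (l.colLen 0) => (l.rowLen i : Coef))
      (shiftedVar (l.colLen 0) i)) = fun i : Fin (l.colLen 0) =>
        (l.rowLen i : Coef) - (((i : ℕ) : Coef) + 1) / α := by
    funext i
    rw [shiftedVar, map_sub, aeval_X, aeval_C]
    rfl
  rw [h2, ← map_component_shiftedMomentSeries] at h
  rw [← h]
  ext1 k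
  rw [PowerSeries.coeff_map, PowerSeries.coeff_map, PowerSeries.coeff_map]
  rfl

/-- The shifted symmetric functions that are polynomials in `1 / α`. -/
def invAlphaSubring : Subring ShiftedSym where
  carrier := {f | ∃ D, ∀ N, component N f ∈ coeffInvAlphaLE (Fin N) D}
  zero_mem' := ⟨0, fun N => by rw [map_zero]; exact AddSubgroup.zero_mem _⟩
  one_mem' := ⟨0, fun N => by rw [map_one]; exact one_mem_coeffInvAlphaLE 0⟩
  add_mem' := by
    rintro f g ⟨D, hD⟩ ⟨E, hE⟩
    refine ⟨max D E, fun N => ?_⟩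
    rw [map_add]
    exact AddSubgroup.add_mem _ (coeffInvAlphaLE_mono (le_max_left _ _) (hD N))
      (coeffInvAlphaLE_mono (le_max_right _ _) (hE N))
  mul_mem' := by
    rintro f g ⟨D, hD⟩ ⟨E, hE⟩
    refine ⟨D + E, fun N => ?_⟩
    rw [map_mul]
    exact mul_mem_coeffInvAlphaLE (hD N) (hE N)
  neg_mem' := by
    rintro f ⟨D, hD⟩
    refine ⟨D, fun N => ?_⟩
    rw [map_neg]
    exact AddSubgroup.neg_mem _ (hD N)

theorem isPolynomialInInvAlpha_of_mem {f : ShiftedSym} (hf : f ∈ invAlphaSubring) :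
    IsPolynomialInInvAlpha f := by
  obtain ⟨D, hD⟩ := hf
  exact ⟨D, fun N m => mem_invAlphaLE.1 (hD N m)⟩

theorem shiftedMoment_mem_invAlphaSubring (k : ℕ) : shiftedMoment k ∈ invAlphaSubring :=
  ⟨k, fun N => rowSeries_mem_invAlphaSeries N k⟩

end ShiftedMoments

/-! ### Moments, Boolean and free cumulants by one recursion -/

section Cumulants

variable {A B : Type*} [CommRing A] [CommRing B]

/-- The cumulants `K_k` of the moment series `M` of type `e`, defined recursively by
`[w^k] M = ∑_{1 ≤ j ≤ k} K_j [w^{k-j}] M^{e j}`.  The exponents `e j = 0`, `e j = 1` and `e j = j`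
give the moments themselves, the Boolean cumulants and the free cumulants. -/
def cumulant (e : ℕ → ℕ) (M : PowerSeries A) (k : ℕ) : A :=
  PowerSeries.coeff k M -
    ∑ j ∈ (Ico 1 k).attach, cumulant e M j * PowerSeries.coeff (k - j) (M ^ e j)
termination_by k
decreasing_by exact (mem_Ico.1 j.2).2

theorem cumulant_eq (e : ℕ → ℕ) (M : PowerSeries A) (k : ℕ) : cumulant e M k =
    PowerSeries.coeff k M -
      ∑ j ∈ Ico 1 k, cumulant e M j * PowerSeries.coeff (k - j) (M ^ e j) := by
  rw [cumulant, sum_attach (Ico 1 k) fun j => cumulant e M j * PowerSeries.coeff (k - j) (M ^ e j)]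

/-- The cumulants are determined by their recursion. -/
theorem eq_cumulant {e : ℕ → ℕ} {M : PowerSeries A} {c : ℕ → A}
    (hM : PowerSeries.coeff 0 M = 1)
    (h : ∀ k, 1 ≤ k → PowerSeries.coeff k M =
      ∑ j ∈ Ico 1 (k + 1), c j * PowerSeries.coeff (k - j) (M ^ e j)) (k : ℕ) (hk : 1 ≤ k) :
    c k = cumulant e M k := by
  induction k using Nat.strong_induction_on with
  | _ k ih =>
  have h0 : PowerSeries.coeff 0 (M ^ e k) = 1 := by
    rw [PowerSeries.coeff_zero_eq_constantCoeff_apply, map_pow,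
      ← PowerSeries.coeff_zero_eq_constantCoeff_apply, hM, one_pow]
  rw [cumulant_eq, h k hk, sum_Ico_succ_top hk, Nat.sub_self, h0, mul_one,
    sum_congr rfl fun j hj => by rw [ih j (mem_Ico.1 hj).2 (mem_Ico.1 hj).1]]
  ring

/-- The recursion uses ring operations only. Hence one cumulant over `ShiftedSym` specialises both
to its N-variable components and to its values at diagrams. -/
theorem map_cumulant (f : A →+* B) (e : ℕ → ℕ) (M : PowerSeries A) (k : ℕ) :
    f (cumulant e M k) = cumulant e (PowerSeries.map f M) k := by
  induction k using Nat.strong_induction_on with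
  | _ k ih =>
  rw [cumulant_eq, cumulant_eq, map_sub, map_sum, PowerSeries.coeff_map]
  congr 1
  refine sum_congr rfl fun j hj => ?_
  rw [map_mul, ih j (mem_Ico.1 hj).2, ← map_pow, PowerSeries.coeff_map]

theorem cumulant_mem (S : Subring A) {M : PowerSeries A} (hM : ∀ k, PowerSeries.coeff k M ∈ S)
    (e : ℕ → ℕ) (k : ℕ) : cumulant e M k ∈ S := by
  have hpow : ∀ n k, PowerSeries.coeff k (M ^ n) ∈ S := by
    intro n
    induction n with
    | zero =>
      intro k
      rw [pow_zero, PowerSeries.coeff_one]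
      split_ifs
      · exact S.one_mem
      · exact S.zero_mem
    | succ n ih =>
      intro k
      rw [pow_succ, PowerSeries.coeff_mul]
      exact S.sum_mem fun x _ => S.mul_mem (ih _) (hM _)
  induction k using Nat.strong_induction_on with
  | _ k ih =>
  rw [cumulant_eq]
  exact S.sub_mem (hM k) (S.sum_mem fun j hj => S.mul_mem (ih j (mem_Ico.1 hj).2) (hpow _ _))

/-- For j ≤ k, the term K_j [w^{k+1-j}] M^{e j} is a product of two factors, each of degree below
its index, so its degree is less than k. The leading form therefore does not depend on e. -/
theorem IsSubmonic.cumulant {σ K : Type*} [Field K] {F : PowerSeries (MvPolynomial σ K)}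
    (hF : IsSubmonic F) (e : ℕ → ℕ) (k : ℕ) :
    cumulant e F (k + 1) ∈ degreeLT σ K (k + 1) ∧
      PowerSeries.coeff (k + 1) F - AnisotropicYoung.cumulant e F (k + 1) ∈ degreeLT σ K k := by
  induction k using Nat.strong_induction_on with
  | _ k ih =>
  have h : PowerSeries.coeff (k + 1) F - AnisotropicYoung.cumulant e F (k + 1) ∈
      degreeLT σ K k := by
    rw [cumulant_eq, sub_sub_cancel]
    refine Submodule.sum_mem _ fun j hj => ?_
    rw [mem_Ico] at hj
    obtain ⟨i, rfl⟩ : ∃ i, j = i + 1 := ⟨j - 1, by omega⟩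
    obtain ⟨n, hn⟩ : ∃ n, k + 1 - (i + 1) = n + 1 := ⟨k - i - 1, by omega⟩
    have h1 := mul_mem_degreeLT (ih i (by omega)).1 ((hF.pow (e (i + 1))).2 n)
    rw [hn]
    rwa [show i + 1 + n = k by omega] at h1
  refine ⟨?_, h⟩
  rw [← sub_sub_cancel (PowerSeries.coeff (k + 1) F) (AnisotropicYoung.cumulant e F (k + 1))]
  exact Submodule.sub_mem _ (hF.2 k) (degreeLT_mono k.le_succ h)

theorem coeff_zero_momentSeries (l : YoungDiagram) : PowerSeries.coeff 0 (momentSeries l) = 1 := by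
  rw [PowerSeries.coeff_zero_eq_constantCoeff_apply, constantCoeff_momentSeries]

/-- With M^0 = 1 only the term j = k survives. -/
theorem moment_eq_cumulant (l : YoungDiagram) (k : ℕ) (hk : 1 ≤ k) :
    moment l k = cumulant (fun _ => 0) (momentSeries l) k := by
  refine eq_cumulant (coeff_zero_momentSeries l) (fun k hk => ?_) k hk
  rw [sum_Ico_succ_top hk, sum_eq_zero]
  · simp [momentSeries]
  · intro j hj
    rw [mem_Ico] at hj
    rw [pow_zero, PowerSeries.coeff_one, if_neg (by omega), mul_zero]

/-- Multiplying M⁻¹ = 1 - ∑ B_j w^j by M gives M = 1 + ∑ B_j w^j M. -/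
theorem booleanCumulant_eq_cumulant (l : YoungDiagram) (k : ℕ) (hk : 1 ≤ k) :
    booleanCumulant l k = cumulant (fun _ => 1) (momentSeries l) k := by
  refine eq_cumulant (coeff_zero_momentSeries l) (fun k hk => ?_) k hk
  have h1 : (momentSeries l)⁻¹ * momentSeries l = 1 :=
    PowerSeries.inv_mul_cancel _ (by rw [constantCoeff_momentSeries]; exact one_ne_zero)
  have h0 : PowerSeries.coeff 0 (momentSeries l)⁻¹ = 1 := by
    rw [PowerSeries.coeff_zero_eq_constantCoeff_apply, PowerSeries.constantCoeff_inv,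
      constantCoeff_momentSeries, inv_one]
  have h2 := congrArg (PowerSeries.coeff k) h1
  rw [PowerSeries.coeff_mul, Finset.Nat.sum_antidiagonal_eq_sum_range_succ_mk,
    PowerSeries.coeff_one, if_neg (by omega), range_eq_Ico,
    sum_eq_sum_Ico_succ_bot (Nat.succ_pos k)] at h2
  simp only [h0, one_mul, Nat.sub_zero, zero_add] at h2
  simp only [booleanCumulant, pow_one, neg_mul, sum_neg_distrib]
  exact eq_neg_of_add_eq_zero_left h2

/-- The functional equation `𝓡(𝓜(z)) = z` of the free cumulants. -/
theorem freeCumulantSeries_subst (l : YoungDiagram) :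
    ((PowerSeries.mk fun n => PowerSeries.coeff (n + 1) (cauchySeriesInv l))⁻¹).subst
      (cauchySeries l) = momentSeries l := by
  set w := PowerSeries.mk fun n => PowerSeries.coeff (n + 1) (cauchySeriesInv l) with hw
  have hX : cauchySeriesInv l = PowerSeries.X * w := by
    ext n
    cases n with
    | zero =>
      rw [PowerSeries.coeff_zero_X_mul, PowerSeries.coeff_zero_eq_constantCoeff_apply]
      exact PowerSeries.constantCoeff_substInvOfIsUnit _ _
    | succ n => rw [PowerSeries.coeff_succ_X_mul, hw, PowerSeries.coeff_mk]
  have hs : PowerSeries.HasSubst (cauchySeries l) :=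
    PowerSeries.HasSubst.of_constantCoeff_zero' (by simp [cauchySeries])
  have h1 : (cauchySeriesInv l).subst (cauchySeries l) = (PowerSeries.X : PowerSeries Coef) :=
    PowerSeries.subst_substInvOfIsUnit_left _ (by simp [cauchySeries]) _
  have hw0 : PowerSeries.constantCoeff w ≠ 0 := by
    rw [← PowerSeries.coeff_zero_eq_constantCoeff_apply, hw, PowerSeries.coeff_mk,
      cauchySeriesInv, PowerSeries.coeff_one_substInvOfIsUnit]
    exact Units.ne_zero _
  have h2 : w⁻¹.subst (cauchySeries l) * w.subst (cauchySeries l) = (1 : PowerSeries Coef) := by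
    rw [← PowerSeries.subst_mul hs, PowerSeries.inv_mul_cancel _ hw0,
      ← PowerSeries.coe_substAlgHom hs, map_one]
  -- Writing the inverse series as u W(u) and putting u = w M(w) gives w M(w) W(w M(w)) = w;
  -- cancelling w identifies M with 1/W at u.
  rw [hX, PowerSeries.subst_mul hs, PowerSeries.subst_X hs, cauchySeries, mul_assoc] at h1
  have h3 : momentSeries l * w.subst (cauchySeries l) = 1 :=
    mul_left_cancel₀ PowerSeries.X_ne_zero (by rw [mul_one]; exact h1)
  calc _ = w⁻¹.subst (cauchySeries l) * (momentSeries l * w.subst (cauchySeries l)) := by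
        rw [h3, mul_one]
    _ = _ := by rw [mul_left_comm, h2, mul_one]

/-- Expanding the functional equation at u = w M gives M = 1 + ∑ R_j w^j M^j. -/
theorem freeCumulant_eq_cumulant (l : YoungDiagram) (k : ℕ) (hk : 1 ≤ k) :
    freeCumulant l k = cumulant (fun j => j) (momentSeries l) k := by
  refine eq_cumulant (coeff_zero_momentSeries l) (fun k hk => ?_) k hk
  have hs : PowerSeries.HasSubst (cauchySeries l) :=
    PowerSeries.HasSubst.of_constantCoeff_zero' (by simp [cauchySeries])
  have h := congrArg (PowerSeries.coeff k) (freeCumulantSeries_subst l)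
  -- The power u^j is divisible by w^j, so only j ≤ k contribute to the coefficient of w^k.
  rw [PowerSeries.coeff_subst' hs, finsum_eq_sum_of_support_subset (s := range (k + 1)),
    range_eq_Ico, sum_eq_sum_Ico_succ_bot (Nat.succ_pos k), pow_zero, PowerSeries.coeff_one,
    if_neg (by omega), smul_zero, zero_add] at h
  · rw [← h]
    refine sum_congr rfl fun j hj => ?_
    rw [mem_Ico] at hj
    rw [smul_eq_mul, cauchySeries, mul_pow, PowerSeries.coeff_X_pow_mul', if_pos (by omega)]
    rfl
  · intro j hj
    rw [coe_range, Set.mem_Iio]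
    by_contra hjk
    refine hj ?_
    simp only
    rw [cauchySeries, mul_pow, PowerSeries.coeff_X_pow_mul', if_neg (by omega), smul_zero]

end Cumulants

/-! ### The three algebraic bases -/

section Main

/-- The cumulants of type `e` form an algebraic basis of the algebra of shifted symmetric
functions. -/
theorem exists_isAlgebraicBasis_cumulant (e : ℕ → ℕ) (v : YoungDiagram → ℕ → Coef)
    (hv : ∀ l k, 1 ≤ k → v l k = cumulant e (momentSeries l) k) :
    ∃ y : {k : ℕ // 2 ≤ k} → ShiftedSym, (∀ k l, evalAt (y k) l = v l k) ∧
      IsAlgebraicBasis y ∧ ∀ k, IsPolynomialInInvAlpha (y k) := by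
  -- The shift by 2 matches K_{k+2} with p_{k+1}/α, so that the indices k ≥ 2 run through all power
  -- sums p_1, p_2, ….
  let z : ℕ → ShiftedSym := fun k => cumulant e shiftedMomentSeries (k + 2)
  have hz : ∀ k N, component N (z k) - scaledPsum (1 / α) N k ∈
      degreeLT (Fin N) Coef (k + 1) := by
    intro k N
    have h1 : component N (z k) = cumulant e (rowSeries (shiftedVar N)) (k + 2) := by
      rw [← map_component_shiftedMomentSeries]
      exact map_cumulant (component N : ShiftedSym →+* MvPolynomial (Fin N) Coef) _ _ _
    rw [h1]
    have h2 := ((isSubmonic_rowSeries N).cumulant e (k + 1)).2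
    convert Submodule.sub_mem _ (coeff_rowSeries_sub_mem_degreeLT N k) h2 using 1
    ring
  have hα : (1 / α : Coef) ≠ 0 := one_div_ne_zero RatFunc.X_ne_zero
  let E : {k : ℕ // 2 ≤ k} ≃ ℕ :=
    { toFun := fun k => k - 2
      invFun := fun k => ⟨k + 2, by omega⟩
      left_inv := fun k => Subtype.ext (Nat.sub_add_cancel k.2)
      right_inv := fun k => Nat.add_sub_cancel k 2 }
  have hE : ∀ k, z (E k) = cumulant e shiftedMomentSeries k := fun k =>
    congrArg (cumulant e shiftedMomentSeries) (Nat.sub_add_cancel k.2)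
  refine ⟨z ∘ E, fun k l => ?_, ⟨?_, ?_⟩, fun k => ?_⟩
  · rw [hv l k (by have := k.2; omega), Function.comp_apply, hE, ← evalHom_apply,
      ← map_evalHom_shiftedMomentSeries]
    exact map_cumulant (evalHom l : ShiftedSym →+* Coef) _ _ _
  · exact (algebraicIndependent_equiv E).2 (algebraicIndependent_of_leading hα hz)
  · rw [Set.range_comp, E.range_eq_univ, Set.image_univ]
    exact adjoin_eq_top_of_leading hα hz
  · refine isPolynomialInInvAlpha_of_mem (cumulant_mem _ (fun k => ?_) _ _)
    rw [shiftedMomentSeries, PowerSeries.coeff_mk]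
    exact shiftedMoment_mem_invAlphaSubring k

end Main

end AnisotropicYoung

end

theorem mainTheorem6 :
    (∃ M : {k : ℕ // 2 ≤ k} → AnisotropicYoung.ShiftedSym,
      (∀ k l, AnisotropicYoung.evalAt (M k) l = AnisotropicYoung.moment l k) ∧
      AnisotropicYoung.IsAlgebraicBasis M ∧
      ∀ k, AnisotropicYoung.IsPolynomialInInvAlpha (M k)) ∧
    (∃ B : {k : ℕ // 2 ≤ k} → AnisotropicYoung.ShiftedSym,
      (∀ k l, AnisotropicYoung.evalAt (B k) l = AnisotropicYoung.booleanCumulant l k) ∧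
      AnisotropicYoung.IsAlgebraicBasis B ∧
      ∀ k, AnisotropicYoung.IsPolynomialInInvAlpha (B k)) ∧
    (∃ R : {k : ℕ // 2 ≤ k} → AnisotropicYoung.ShiftedSym,
      (∀ k l, AnisotropicYoung.evalAt (R k) l = AnisotropicYoung.freeCumulant l k) ∧
      AnisotropicYoung.IsAlgebraicBasis R ∧
      ∀ k, AnisotropicYoung.IsPolynomialInInvAlpha (R k)) :=
  ⟨AnisotropicYoung.exists_isAlgebraicBasis_cumulant _ _ AnisotropicYoung.moment_eq_cumulant,
    AnisotropicYoung.exists_isAlgebraicBasis_cumulant _ _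
      AnisotropicYoung.booleanCumulant_eq_cumulant,
    AnisotropicYoung.exists_isAlgebraicBasis_cumulant _ _
      AnisotropicYoung.freeCumulant_eq_cumulant⟩
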